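/- Let $\Bbbk$ be a field of characteristic zero. The twisted Heisenberg category $\mathcal H^t$ is the additive, graded idempotent completion of the following $\Bbbk$-linear strict monoidal supercategory (all morphisms, even and odd, are kept). Its objects are generated by $\mathsf P$ and $\mathsf Q$. Its morphisms are generated by the even morphisms $$s:\mathsf{PP}\to\mathsf{PP},\quad \varepsilon:\mathsf{QP}\to 1,\quad \eta':1\to\mathsf{QP},\quad \varepsilon':\mathsf{PQ}\to 1,\quad \eta:1\to\mathsf{PQ}$$ (upward crossing, counterclockwise cap and cup, clockwise cap and cup) and the odd morphisms $c:\mathsf P\to\mathsf P$, $\bar c:\mathsf Q\to\mathsf Q$ (hollow dots). Here $g\circ f$ means $g$ on top of $f$, tensor products are read from left to right, identity morphisms in tensor products are written as objects, and the super interchange law is $(g\otimes g')\circ(f\otimes f')=(-1)^{|g'||f|}(g\circ f)\otimes(g'\circ f')$. The relations are: * (isotopy) $(\mathsf P\otimes\varepsilon)(\eta\otimes\mathsf P)=\mathrm{id}_{\mathsf P}=(\varepsilon'\otimes\mathsf P)(\mathsf P\otimes\eta')$ and $(\varepsilon\otimes\mathsf Q)(\mathsf Q\otimes\eta)=\mathrm{id}_{\mathsf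 Q}=(\mathsf Q\otimes\varepsilon')(\eta'\otimes\mathsf Q)$; the two downward crossings $\mathsf{QQ}\to\mathsf{QQ}$ obtained by rotating $s$ by a half turn in either direction agree; * $s^2=\mathrm{id}$ and $(s\otimes\mathsf P)(\mathsf P\otimes s)(s\otimes\mathsf P)=(\mathsf P\otimes s)(s\otimes\mathsf P)(\mathsf P\otimes s)$; * with the sideways crossings $t=(\mathsf{QP}\otimes\varepsilon')(\mathsf Q\otimes s\otimes\mathsf Q)(\eta'\otimes\mathsf{PQ}):\mathsf{PQ}\to\mathsf{QP}$ and $t'=(\varepsilon\otimes\mathsf{PQ})(\mathsf Q\otimes s\otimes\mathsf Q)(\mathsf{QP}\otimes\eta):\mathsf{QP}\to\mathsf{PQ}$, one has $t't=\mathrm{id}_{\mathsf{PQ}}$ and $tt'=\mathrm{id}_{\mathsf{QP}}-\eta'\varepsilon-(\bar c\otimes\mathsf P)\,\eta'\,\varepsilon\,(\mathsf Q\otimes c)$; * $\varepsilon\eta'=1$, and the left curl vanishes: $(\varepsilon\otimes\mathsf P)(\mathsf Q\otimes s)(\eta'\otimes\mathsf P)=0$; * $s(c\otimes\mathsf P)=(\mathsf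 P\otimes c)s$ and $(c\otimes\mathsf P)s=s(\mathsf P\otimes c)$; * $\varepsilon(\bar c\otimes\mathsf P)=-\varepsilon(\mathsf Q\otimes c)$, $\varepsilon'(c\otimes\mathsf Q)=\varepsilon'(\mathsf P\otimes\bar c)$, $(\bar c\otimes\mathsf P)\eta'=(\mathsf Q\otimes c)\eta'$, $(c\otimes\mathsf Q)\eta=-(\mathsf P\otimes\bar c)\eta$; * $c^2=\mathrm{id}_{\mathsf P}$, $\bar c^2=-\mathrm{id}_{\mathsf Q}$, $\varepsilon(\mathsf Q\otimes c)\eta'=0$. Let $n\ge 0$, and number the strands of $\mathsf P^n$ from left to right by $1,\dots,n$. In $\operatorname{End}(\mathsf P^n)$ let $T_i$ $(1\le i<n)$ be the crossing $s$ of the strands $i$ and $i+1$, and let $C_i$ and $X_i$ $(1\le i\le n)$ be, respectively, the hollow dot $c$ and the right curl $(\mathsf P\otimes\varepsilon')(s\otimes\mathsf Q)(\mathsf P\otimes\eta)$ on the strand $i$. Then in $\operatorname{End}(\mathsf P^n)$, with product $fg=f\circ g$, the affine Sergeev relations hold: $$\begin{aligned} T_iX_i&=X_{i+1}T_i+1+C_iC_{i+1}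 &&(1\le i<n),\\ X_iT_i&=T_iX_{i+1}+1-C_iC_{i+1} &&(1\le i<n),\\ C_iX_j&=(-1)^{\delta_{i,j}}X_jC_i &&(1\le i,j\le n),\\ X_iX_j&=X_jX_i &&(1\le i,j\le n). \end{aligned}$$ -/

import Mathlib

open CategoryTheory

universe u

namespace TwistedHeisenberg

/-! ## Diagrams

Oriented string diagrams are read from bottom (source) to top (target). An object is a word in
`P` (upward strand) and `Q` (downward strand), and the tensor product of words is concatenation. -/

/-- The two generating objects: `P`, an upward strand, and `Q`, a downward strand. -/
inductive Strand : Type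
  | P
  | Q

open Strand

/-- Tensor products of the generating objects; the empty word is the unit object. -/
abbrev Word : Type := List Strand

/-- The generating morphisms: the upward crossing, the four cups and caps (oriented clockwise or
counterclockwise), and the hollow dots on an upward and on a downward strand. -/
inductive Generator : Word → Word → Type
  | cross : Generator [P, P] [P, P]
  | capQP : Generator [Q, P] []
  | cupQP : Generator [] [Q, P]
  | capPQ : Generator [P, Q] []
  | cupPQ : Generator [] [P, Q]
  | dotP : Generator [P] [P]
  | dotQ : Generator [Q] [Q]

/-- Hollow dots are odd, all other generators are even. -/
def Generator.parity : {a b : Word} → Generator a b → ZMod 2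
  | _, _, .dotP => 1
  | _, _, .dotQ => 1
  | _, _, .cross => 0
  | _, _, .capQP => 0
  | _, _, .cupQP => 0
  | _, _, .capPQ => 0
  | _, _, .cupPQ => 0

/-- Formal `k`-linear expressions built from the generators by vertical composition and
horizontal juxtaposition. In `tensor` the source and target are only required to be equal to the
concatenated words, so that strict associativity of `++` needs no transport. -/
inductive Diagram (k : Type u) : Word → Word → Type u
  | gen {a b : Word} (g : Generator a b) : Diagram k a b
  | id (a : Word) : Diagram k a a
  /-- `comp g f` is the diagram `g` on top of the diagram `f`. -/
  | comp {a b c : Word} (g : Diagram k b c) (f : Diagram k a b) : Diagram k a c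
  /-- `tensor f g` is the diagram `f` to the left of the diagram `g`. -/
  | tensor {a b c d s t : Word} (f : Diagram k a b) (g : Diagram k c d)
      (hs : s = a ++ c) (ht : t = b ++ d) : Diagram k s t
  | zero (a b : Word) : Diagram k a b
  | sum {a b : Word} (f g : Diagram k a b) : Diagram k a b
  | smul {a b : Word} (r : k) (f : Diagram k a b) : Diagram k a b

namespace Diagram

/-- `f.HasParity p`: the expression `f` is homogeneous of parity `p`. -/
inductive HasParity {k : Type u} : {a b : Word} → Diagram k a b → ZMod 2 → Prop
  | gen {a b : Word} (g : Generator a b) : HasParity (gen g) g.parity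
  | id (a : Word) : HasParity (id a) 0
  | comp {a b c : Word} {g : Diagram k b c} {f : Diagram k a b} {p q : ZMod 2} :
      HasParity g p → HasParity f q → HasParity (comp g f) (p + q)
  | tensor {a b c d s t : Word} {f : Diagram k a b} {g : Diagram k c d}
      {hs : s = a ++ c} {ht : t = b ++ d} {p q : ZMod 2} :
      HasParity f p → HasParity g q → HasParity (tensor f g hs ht) (p + q)
  | zero (a b : Word) (p : ZMod 2) : HasParity (zero a b) p
  | sum {a b : Word} {f g : Diagram k a b} {p : ZMod 2} :
      HasParity f p → HasParity g p → HasParity (sum f g) p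
  | smul {a b : Word} (r : k) {f : Diagram k a b} {p : ZMod 2} :
      HasParity f p → HasParity (smul r f) p

end Diagram

local infixr:80 " ∘ᵈ " => Diagram.comp
local notation:86 f:86 " ⊗ᵈ " g:87 => Diagram.tensor f g rfl rfl
local infixl:65 " +ᵈ " => Diagram.sum
local infixr:82 " •ᵈ " => Diagram.smul
local notation "𝟭" a:max => Diagram.id a

namespace Diagram

variable (k : Type u)

/-- The crossing of two upward strands. -/
abbrev cross : Diagram k [P, P] [P, P] := gen .cross
/-- The counterclockwise cap. -/
abbrev capQP : Diagram k [Q, P] [] := gen .capQP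
/-- The counterclockwise cup. -/
abbrev cupQP : Diagram k [] [Q, P] := gen .cupQP
/-- The clockwise cap. -/
abbrev capPQ : Diagram k [P, Q] [] := gen .capPQ
/-- The clockwise cup. -/
abbrev cupPQ : Diagram k [] [P, Q] := gen .cupPQ
/-- The hollow dot on an upward strand. -/
abbrev dotP : Diagram k [P] [P] := gen .dotP
/-- The hollow dot on a downward strand. -/
abbrev dotQ : Diagram k [Q] [Q] := gen .dotQ

/-- The crossing `PQ ⟶ QP`: the upward crossing rotated by a quarter turn. -/
def crossPQ : Diagram k [P, Q] [Q, P] :=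
  (𝟭 [Q, P] ⊗ᵈ capPQ k) ∘ᵈ (𝟭 [Q] ⊗ᵈ cross k ⊗ᵈ 𝟭 [Q]) ∘ᵈ (cupQP k ⊗ᵈ 𝟭 [P, Q])

/-- The crossing `QP ⟶ PQ`: the upward crossing rotated by a quarter turn the other way. -/
def crossQP : Diagram k [Q, P] [P, Q] :=
  (capQP k ⊗ᵈ 𝟭 [P, Q]) ∘ᵈ (𝟭 [Q] ⊗ᵈ cross k ⊗ᵈ 𝟭 [Q]) ∘ᵈ (𝟭 [Q, P] ⊗ᵈ cupPQ k)

/-- The crossing of two downward strands: the upward crossing rotated by a half turn, bending its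
two upper ends to the left and its two lower ends to the right. -/
def crossQQ : Diagram k [Q, Q] [Q, Q] :=
  (capQP k ⊗ᵈ 𝟭 [Q, Q]) ∘ᵈ (𝟭 [Q] ⊗ᵈ capQP k ⊗ᵈ 𝟭 [P, Q, Q]) ∘ᵈ
    (𝟭 [Q, Q] ⊗ᵈ cross k ⊗ᵈ 𝟭 [Q, Q]) ∘ᵈ
    (𝟭 [Q, Q, P] ⊗ᵈ cupPQ k ⊗ᵈ 𝟭 [Q]) ∘ᵈ (𝟭 [Q, Q] ⊗ᵈ cupPQ k)

/-- The upward crossing rotated by a half turn in the opposite direction. -/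
def crossQQ' : Diagram k [Q, Q] [Q, Q] :=
  (𝟭 [Q, Q] ⊗ᵈ capPQ k) ∘ᵈ (𝟭 [Q, Q, P] ⊗ᵈ capPQ k ⊗ᵈ 𝟭 [Q]) ∘ᵈ
    (𝟭 [Q, Q] ⊗ᵈ cross k ⊗ᵈ 𝟭 [Q, Q]) ∘ᵈ
    (𝟭 [Q] ⊗ᵈ cupQP k ⊗ᵈ 𝟭 [P, Q, Q]) ∘ᵈ (cupQP k ⊗ᵈ 𝟭 [Q, Q])

/-- The curl on an upward strand whose loop lies to the right of the strand (a solid dot). -/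
def curl : Diagram k [P] [P] :=
  (𝟭 [P] ⊗ᵈ capPQ k) ∘ᵈ (cross k ⊗ᵈ 𝟭 [Q]) ∘ᵈ (𝟭 [P] ⊗ᵈ cupPQ k)

/-- The curl on an upward strand whose loop lies to the left of the strand. -/
def leftCurl : Diagram k [P] [P] :=
  (capQP k ⊗ᵈ 𝟭 [P]) ∘ᵈ (𝟭 [Q] ⊗ᵈ cross k) ∘ᵈ (cupQP k ⊗ᵈ 𝟭 [P])

/-- The defining relations of the `k`-linear strict monoidal supercategory of diagrams. -/
inductive Rel {k : Type u} [CommRing k] :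
    {a b : Word} → Diagram k a b → Diagram k a b → Prop
  -- congruence
  | refl {a b : Word} (f : Diagram k a b) : Rel f f
  | symm {a b : Word} {f g : Diagram k a b} : Rel f g → Rel g f
  | trans {a b : Word} {f g h : Diagram k a b} : Rel f g → Rel g h → Rel f h
  | comp {a b c : Word} {g g' : Diagram k b c} {f f' : Diagram k a b} :
      Rel g g' → Rel f f' → Rel (g ∘ᵈ f) (g' ∘ᵈ f')
  | tensor {a b c d s t : Word} {f f' : Diagram k a b} {g g' : Diagram k c d}
      (hs : s = a ++ c) (ht : t = b ++ d) :
      Rel f f' → Rel g g' → Rel (.tensor f g hs ht) (.tensor f' g' hs ht)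
  | sum {a b : Word} {f f' g g' : Diagram k a b} :
      Rel f f' → Rel g g' → Rel (f +ᵈ g) (f' +ᵈ g')
  | smul {a b : Word} (r : k) {f f' : Diagram k a b} : Rel f f' → Rel (r •ᵈ f) (r •ᵈ f')
  -- morphism spaces are `k`-modules
  | sum_assoc {a b : Word} (f g h : Diagram k a b) : Rel (f +ᵈ g +ᵈ h) (f +ᵈ (g +ᵈ h))
  | sum_comm {a b : Word} (f g : Diagram k a b) : Rel (f +ᵈ g) (g +ᵈ f)
  | zero_sum {a b : Word} (f : Diagram k a b) : Rel (zero a b +ᵈ f) f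
  | neg_sum {a b : Word} (f : Diagram k a b) : Rel ((-1 : k) •ᵈ f +ᵈ f) (zero a b)
  | one_smul {a b : Word} (f : Diagram k a b) : Rel ((1 : k) •ᵈ f) f
  | mul_smul {a b : Word} (r r' : k) (f : Diagram k a b) : Rel ((r * r') •ᵈ f) (r •ᵈ r' •ᵈ f)
  | smul_sum {a b : Word} (r : k) (f g : Diagram k a b) : Rel (r •ᵈ (f +ᵈ g)) (r •ᵈ f +ᵈ r •ᵈ g)
  | sum_smul {a b : Word} (r r' : k) (f : Diagram k a b) :
      Rel ((r + r') •ᵈ f) (r •ᵈ f +ᵈ r' •ᵈ f)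
  -- vertical composition is associative, unital and bilinear
  | id_comp {a b : Word} (f : Diagram k a b) : Rel (𝟭 b ∘ᵈ f) f
  | comp_id {a b : Word} (f : Diagram k a b) : Rel (f ∘ᵈ 𝟭 a) f
  | comp_assoc {a b c d : Word} (h : Diagram k c d) (g : Diagram k b c) (f : Diagram k a b) :
      Rel ((h ∘ᵈ g) ∘ᵈ f) (h ∘ᵈ (g ∘ᵈ f))
  | sum_comp {a b c : Word} (g g' : Diagram k b c) (f : Diagram k a b) :
      Rel ((g +ᵈ g') ∘ᵈ f) (g ∘ᵈ f +ᵈ g' ∘ᵈ f)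
  | comp_sum {a b c : Word} (g : Diagram k b c) (f f' : Diagram k a b) :
      Rel (g ∘ᵈ (f +ᵈ f')) (g ∘ᵈ f +ᵈ g ∘ᵈ f')
  | smul_comp {a b c : Word} (r : k) (g : Diagram k b c) (f : Diagram k a b) :
      Rel ((r •ᵈ g) ∘ᵈ f) (r •ᵈ (g ∘ᵈ f))
  | comp_smul {a b c : Word} (r : k) (g : Diagram k b c) (f : Diagram k a b) :
      Rel (g ∘ᵈ (r •ᵈ f)) (r •ᵈ (g ∘ᵈ f))
  -- horizontal juxtaposition is strictly associative, strictly unital and bilinear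
  | id_tensor_id {a b s : Word} (hs hs' : s = a ++ b) : Rel (.tensor (𝟭 a) (𝟭 b) hs hs') (𝟭 s)
  | unit_tensor {a b : Word} (f : Diagram k a b) (hs : a = [] ++ a) (ht : b = [] ++ b) :
      Rel (.tensor (𝟭 []) f hs ht) f
  | tensor_unit {a b : Word} (f : Diagram k a b) (hs : a = a ++ []) (ht : b = b ++ []) :
      Rel (.tensor f (𝟭 []) hs ht) f
  | tensor_assoc {a b c a' b' c' ab ab' bc bc' s t : Word}
      (f : Diagram k a a') (g : Diagram k b b') (h : Diagram k c c')
      (h₁ : ab = a ++ b) (h₁' : ab' = a' ++ b') (h₂ : s = ab ++ c) (h₂' : t = ab' ++ c')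
      (h₃ : bc = b ++ c) (h₃' : bc' = b' ++ c') (h₄ : s = a ++ bc) (h₄' : t = a' ++ bc') :
      Rel (.tensor (.tensor f g h₁ h₁') h h₂ h₂') (.tensor f (.tensor g h h₃ h₃') h₄ h₄')
  | sum_tensor {a b c d s t : Word} (f f' : Diagram k a b) (g : Diagram k c d)
      (hs : s = a ++ c) (ht : t = b ++ d) :
      Rel (.tensor (f +ᵈ f') g hs ht) (.tensor f g hs ht +ᵈ .tensor f' g hs ht)
  | tensor_sum {a b c d s t : Word} (f : Diagram k a b) (g g' : Diagram k c d)
      (hs : s = a ++ c) (ht : t = b ++ d) :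
      Rel (.tensor f (g +ᵈ g') hs ht) (.tensor f g hs ht +ᵈ .tensor f g' hs ht)
  | smul_tensor {a b c d s t : Word} (r : k) (f : Diagram k a b) (g : Diagram k c d)
      (hs : s = a ++ c) (ht : t = b ++ d) :
      Rel (.tensor (r •ᵈ f) g hs ht) (r •ᵈ .tensor f g hs ht)
  | tensor_smul {a b c d s t : Word} (r : k) (f : Diagram k a b) (g : Diagram k c d)
      (hs : s = a ++ c) (ht : t = b ++ d) :
      Rel (.tensor f (r •ᵈ g) hs ht) (r •ᵈ .tensor f g hs ht)
  -- super interchange law; in particular odd diagrams far apart anticommute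
  | interchange {a b c a' b' c' s t w : Word} {g : Diagram k b c} {f : Diagram k a b}
      {g' : Diagram k b' c'} {f' : Diagram k a' b'} {p q : ZMod 2}
      (hs : s = a ++ a') (ht : t = b ++ b') (hw : w = c ++ c') :
      HasParity g' p → HasParity f q →
      Rel (.tensor g g' ht hw ∘ᵈ .tensor f f' hs ht)
        (((-1 : k) ^ (p.val * q.val)) •ᵈ .tensor (g ∘ᵈ f) (g' ∘ᵈ f') hs hw)
  -- planar isotopy: straightening of strands
  | zigzag₁ : Rel ((𝟭 [P] ⊗ᵈ capQP k) ∘ᵈ (cupPQ k ⊗ᵈ 𝟭 [P])) (𝟭 [P])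
  | zigzag₂ : Rel ((capPQ k ⊗ᵈ 𝟭 [P]) ∘ᵈ (𝟭 [P] ⊗ᵈ cupQP k)) (𝟭 [P])
  | zigzag₃ : Rel ((capQP k ⊗ᵈ 𝟭 [Q]) ∘ᵈ (𝟭 [Q] ⊗ᵈ cupPQ k)) (𝟭 [Q])
  | zigzag₄ : Rel ((𝟭 [Q] ⊗ᵈ capPQ k) ∘ᵈ (cupQP k ⊗ᵈ 𝟭 [Q])) (𝟭 [Q])
  -- planar isotopy: both half turns of the upward crossing agree
  | rotation : Rel (crossQQ k) (crossQQ' k)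
  -- upward crossings satisfy the relations of the symmetric group
  | cross_cross : Rel (cross k ∘ᵈ cross k) (𝟭 [P, P])
  | braid : Rel ((cross k ⊗ᵈ 𝟭 [P]) ∘ᵈ (𝟭 [P] ⊗ᵈ cross k) ∘ᵈ (cross k ⊗ᵈ 𝟭 [P]))
      ((𝟭 [P] ⊗ᵈ cross k) ∘ᵈ (cross k ⊗ᵈ 𝟭 [P]) ∘ᵈ (𝟭 [P] ⊗ᵈ cross k))
  -- sideways double crossings
  | cross_PQ : Rel (crossQP k ∘ᵈ crossPQ k) (𝟭 [P, Q])
  | cross_QP : Rel (crossPQ k ∘ᵈ crossQP k)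
      (𝟭 [Q, P] +ᵈ (-1 : k) •ᵈ (cupQP k ∘ᵈ capQP k) +ᵈ
        (-1 : k) •ᵈ (((dotQ k ⊗ᵈ 𝟭 [P]) ∘ᵈ cupQP k) ∘ᵈ (capQP k ∘ᵈ (𝟭 [Q] ⊗ᵈ dotP k))))
  -- counterclockwise circle and left curl
  | circle : Rel (capQP k ∘ᵈ cupQP k) (𝟭 [])
  | left_curl : Rel (leftCurl k) (zero [P] [P])
  -- dots slide through crossings
  | dot_cross : Rel (cross k ∘ᵈ (dotP k ⊗ᵈ 𝟭 [P])) ((𝟭 [P] ⊗ᵈ dotP k) ∘ᵈ cross k)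
  | cross_dot : Rel ((dotP k ⊗ᵈ 𝟭 [P]) ∘ᵈ cross k) (cross k ∘ᵈ (𝟭 [P] ⊗ᵈ dotP k))
  -- dots slide around caps and cups
  | dot_capQP : Rel (capQP k ∘ᵈ (dotQ k ⊗ᵈ 𝟭 [P]))
      ((-1 : k) •ᵈ (capQP k ∘ᵈ (𝟭 [Q] ⊗ᵈ dotP k)))
  | dot_capPQ : Rel (capPQ k ∘ᵈ (dotP k ⊗ᵈ 𝟭 [Q])) (capPQ k ∘ᵈ (𝟭 [P] ⊗ᵈ dotQ k))
  | dot_cupQP : Rel ((dotQ k ⊗ᵈ 𝟭 [P]) ∘ᵈ cupQP k) ((𝟭 [Q] ⊗ᵈ dotP k) ∘ᵈ cupQP k)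
  | dot_cupPQ : Rel ((dotP k ⊗ᵈ 𝟭 [Q]) ∘ᵈ cupPQ k)
      ((-1 : k) •ᵈ ((𝟭 [P] ⊗ᵈ dotQ k) ∘ᵈ cupPQ k))
  -- double dots and the dotted circle
  | dotP_dotP : Rel (dotP k ∘ᵈ dotP k) (𝟭 [P])
  | dotQ_dotQ : Rel (dotQ k ∘ᵈ dotQ k) ((-1 : k) •ᵈ 𝟭 [Q])
  | dot_circle : Rel (capQP k ∘ᵈ (𝟭 [Q] ⊗ᵈ dotP k) ∘ᵈ cupQP k) (zero [] [])

instance setoid (k : Type u) [CommRing k] (a b : Word) : Setoid (Diagram k a b) where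
  r := Rel
  iseqv := ⟨Rel.refl, Rel.symm, Rel.trans⟩

end Diagram

/-! ## The diagrammatic supercategory -/

/-- Morphisms between words of both parities: diagrams modulo relations. -/
def DHom (k : Type u) [CommRing k] (a b : Word) : Type u := Quotient (Diagram.setoid k a b)

namespace DHom

variable {k : Type u} [CommRing k]

/-- The morphism represented by a diagram. -/
def mk {a b : Word} (f : Diagram k a b) : DHom k a b := Quotient.mk _ f

/-- Vertical composition, `g` on top of `f`. -/
def comp {a b c : Word} (g : DHom k b c) (f : DHom k a b) : DHom k a c :=
  Quotient.map₂ Diagram.comp (fun _ _ hg _ _ hf => Diagram.Rel.comp hg hf) g f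

/-- Horizontal juxtaposition, `f` to the left of `g`. -/
def tensor {a b c d s t : Word} (f : DHom k a b) (g : DHom k c d)
    (hs : s = a ++ c) (ht : t = b ++ d) : DHom k s t :=
  Quotient.map₂ (fun f g => Diagram.tensor f g hs ht)
    (fun _ _ hf _ _ hg => Diagram.Rel.tensor hs ht hf hg) f g

/-- The homogeneous morphisms of parity `p`. -/
def HasParity {a b : Word} (f : DHom k a b) (p : ZMod 2) : Prop :=
  ∃ F : Diagram k a b, F.HasParity p ∧ mk F = f

instance (a b : Word) : Add (DHom k a b) :=
  ⟨Quotient.map₂ Diagram.sum fun _ _ hf _ _ hg => Diagram.Rel.sum hf hg⟩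

instance (a b : Word) : Zero (DHom k a b) := ⟨mk (.zero a b)⟩

instance (a b : Word) : SMul k (DHom k a b) :=
  ⟨fun r => Quotient.map (Diagram.smul r) fun _ _ hf => Diagram.Rel.smul r hf⟩

instance (a b : Word) : Neg (DHom k a b) := ⟨fun f => (-1 : k) • f⟩

instance (a b : Word) : AddCommGroup (DHom k a b) where
  add_assoc := by
    rintro ⟨f⟩ ⟨g⟩ ⟨h⟩
    exact Quotient.sound (Diagram.Rel.sum_assoc f g h)
  add_comm := by
    rintro ⟨f⟩ ⟨g⟩
    exact Quotient.sound (Diagram.Rel.sum_comm f g)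
  zero_add := by
    rintro ⟨f⟩
    exact Quotient.sound (Diagram.Rel.zero_sum f)
  add_zero := by
    rintro ⟨f⟩
    exact Quotient.sound ((Diagram.Rel.sum_comm _ _).trans (Diagram.Rel.zero_sum f))
  neg_add_cancel := by
    rintro ⟨f⟩
    exact Quotient.sound (Diagram.Rel.neg_sum f)
  nsmul := nsmulRec
  zsmul := zsmulRec

instance (a b : Word) : Module k (DHom k a b) :=
  Module.ofMinimalAxioms
    (by rintro r ⟨f⟩ ⟨g⟩; exact Quotient.sound (Diagram.Rel.smul_sum r f g))
    (by rintro r r' ⟨f⟩; exact Quotient.sound (Diagram.Rel.sum_smul r r' f))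
    (by rintro r r' ⟨f⟩; exact Quotient.sound (Diagram.Rel.mul_smul r r' f))
    (by rintro ⟨f⟩; exact Quotient.sound (Diagram.Rel.one_smul f))

end DHom

/-- Words with a formal grading shift: `⟨w, s⟩` stands for `w{s}`. -/
structure Shifted (k : Type u) : Type where
  word : Word
  shift : ZMod 2

namespace Shifted

variable {k : Type u} [CommRing k]

instance : Category.{u} (Shifted k) where
  Hom x y := DHom k x.word y.word
  id x := DHom.mk (.id x.word)
  comp f g := DHom.comp g f
  id_comp := by
    rintro _ _ ⟨f⟩
    exact Quotient.sound (Diagram.Rel.comp_id f)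
  comp_id := by
    rintro _ _ ⟨f⟩
    exact Quotient.sound (Diagram.Rel.id_comp f)
  assoc := by
    rintro _ _ _ _ ⟨f⟩ ⟨g⟩ ⟨h⟩
    exact Quotient.sound (Diagram.Rel.comp_assoc h g f).symm

instance : Preadditive (Shifted k) where
  homGroup x y := inferInstanceAs (AddCommGroup (DHom k x.word y.word))
  add_comp := by
    rintro _ _ _ ⟨f⟩ ⟨f'⟩ ⟨g⟩
    exact Quotient.sound (Diagram.Rel.comp_sum g f f')
  comp_add := by
    rintro _ _ _ ⟨f⟩ ⟨g⟩ ⟨g'⟩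
    exact Quotient.sound (Diagram.Rel.sum_comp g g' f)

instance : Linear k (Shifted k) where
  homModule x y := inferInstanceAs (Module k (DHom k x.word y.word))
  smul_comp := by
    rintro _ _ _ r ⟨f⟩ ⟨g⟩
    exact Quotient.sound (Diagram.Rel.comp_smul r g f)
  comp_smul := by
    rintro _ _ _ ⟨f⟩ r ⟨g⟩
    exact Quotient.sound (Diagram.Rel.smul_comp r g f)

/-- The degree of a morphism, taking the shifts of its source and target into account. -/
def HasDegree {x y : Shifted k} (f : x ⟶ y) (p : ZMod 2) : Prop :=
  DHom.HasParity (k := k) (a := x.word) (b := y.word) f (p + x.shift + y.shift)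

end Shifted

/-! ## The twisted Heisenberg category

Finite direct sums are adjoined to the diagrammatic supercategory, then images of even
idempotents. Morphisms of both parities are kept, so `End` is a superalgebra. -/

section Linear

variable (k : Type u) [CommRing k] (C : Type*) [Category C] [Preadditive C] [Linear k C]

instance matLinear : Linear k (Mat_ C) where
  homModule M N :=
    { smul := fun r f i j => r • f i j
      one_smul := fun f => by ext i j; exact one_smul k (f i j)
      mul_smul := fun r r' f => by ext i j; exact mul_smul r r' (f i j)
      smul_zero := fun r => by ext i j; exact smul_zero r
      smul_add := fun r f g => by ext i j; exact smul_add r (f i j) (g i j)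
      add_smul := fun r r' f => by ext i j; exact add_smul r r' (f i j)
      zero_smul := fun f => by ext i j; exact zero_smul k (f i j) }
  smul_comp M N K r f g := by
    ext i j
    change ∑ l, (r • f i l) ≫ g l j = r • ∑ l, f i l ≫ g l j
    simp [Finset.smul_sum]
  comp_smul M N K f r g := by
    ext i j
    change ∑ l, f i l ≫ (r • g l j) = r • ∑ l, f i l ≫ g l j
    simp [Finset.smul_sum]

instance karoubiLinear : Linear k (Idempotents.Karoubi C) where
  homModule A B :=
    { smul := fun r f => ⟨r • f.f, by rw [Linear.smul_comp, Linear.comp_smul, f.comm]⟩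
      one_smul := fun f => by ext; exact one_smul k f.f
      mul_smul := fun r r' f => by ext; exact mul_smul r r' f.f
      smul_zero := fun r => by ext; exact smul_zero r
      smul_add := fun r f g => by ext; exact smul_add r f.f g.f
      add_smul := fun r r' f => by ext; exact add_smul r r' f.f
      zero_smul := fun f => by ext; exact zero_smul k f.f }
  smul_comp _ _ _ r f g := by ext; exact Linear.smul_comp _ _ _ r f.f g.f
  comp_smul _ _ _ f r g := by ext; exact Linear.comp_smul _ _ _ f.f r g.f

end Linear

/-- The idempotents of degree zero. -/
def evenIdempotents (k : Type u) [CommRing k] :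
    ObjectProperty (Idempotents.Karoubi (Mat_ (Shifted k))) :=
  fun A => ∀ i j : A.X.ι, Shifted.HasDegree (A.p i j) 0

/-- The twisted Heisenberg category: the additive, graded idempotent completion of the
supercategory of diagrams. -/
abbrev Ht (k : Type u) [CommRing k] : Type _ := (evenIdempotents k).FullSubcategory

namespace Ht

variable (k : Type u) [CommRing k]

theorem evenIdempotents_embedding (x : Shifted k) :
    evenIdempotents k ((Idempotents.toKaroubi _).obj ((Mat_.embedding _).obj x)) := by
  rintro ⟨⟩ ⟨⟩
  refine ⟨.id x.word, ?_, ?_⟩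
  · have h : (0 : ZMod 2) + x.shift + x.shift = 0 := by
      rw [zero_add]; exact CharTwo.add_self_eq_zero _
    have h' := Diagram.HasParity.id (k := k) x.word
    rw [← h] at h'
    exact h'
  · exact (Mat_.id_apply_self ((Mat_.embedding _).obj x) PUnit.unit).symm

/-- The inclusion of (shifted) words into the twisted Heisenberg category. -/
noncomputable def incl : Shifted k ⥤ Ht k :=
  (evenIdempotents k).lift (Mat_.embedding _ ⋙ Idempotents.toKaroubi _)
    (evenIdempotents_embedding k)

/-- The word `P ⋯ P` with `n` letters. -/
abbrev powP (n : ℕ) : Word := List.replicate n P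

/-- The object `P^n` of the twisted Heisenberg category. -/
noncomputable def Pn (n : ℕ) : Ht k := (incl k).obj ⟨powP n, 0⟩

variable {k}

/-- The endomorphism of `P^n` given by a diagram. -/
noncomputable def toEnd {n : ℕ} (f : DHom k (powP n) (powP n)) : End (Pn k n) :=
  (incl k).map (X := ⟨powP n, 0⟩) (Y := ⟨powP n, 0⟩) f

theorem powP_eq {n a m : ℕ} (h : a + m ≤ n) :
    powP n = powP a ++ (powP m ++ powP (n - a - m)) := by
  simp only [powP, List.replicate_append_replicate]
  congr 1
  omega

/-- `id_{P^a} ⊗ f ⊗ id_{P^(n-a-m)}`: the diagram `f` on the strands `a, …, a + m - 1` (counted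
from the left, starting with `0`) of `P^n`. -/
noncomputable def place {n : ℕ} (a m : ℕ) (h : a + m ≤ n) (f : DHom k (powP m) (powP m)) : End (Pn k n) :=
  toEnd (DHom.tensor (DHom.mk (.id (powP a)))
    (DHom.tensor f (DHom.mk (.id (powP (n - a - m)))) rfl rfl) (powP_eq h) (powP_eq h))

variable (k)

/-- `T_i`: the crossing of the strands `i` and `i + 1` of `P^n`. -/
noncomputable def T (n : ℕ) (i : ℕ) (h : i + 1 < n) : End (Pn k n) := place i 2 h (DHom.mk (Diagram.cross k))

/-- `C_i`: the hollow dot on the strand `i` of `P^n`. -/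
noncomputable def C (n : ℕ) (i : Fin n) : End (Pn k n) := place i 1 i.isLt (DHom.mk (Diagram.dotP k))

/-- `X_i`: the (right) curl on the strand `i` of `P^n`. -/
noncomputable def X (n : ℕ) (i : Fin n) : End (Pn k n) := place i 1 i.isLt (DHom.mk (Diagram.curl k))

end Ht

end TwistedHeisenberg

/-! All four relations reduce to computations on at most two strands, which are then inserted among
identity strands of `P^n`. Write `s` for the crossing, `t : PQ ⟶ QP` and `t' : QP ⟶ PQ` for the
sideways crossings, and `X₁, X₂, c₁, c₂` for curls and dots on two upward strands.

The heart is `cross_comp_curl_comp_cross`: `s X₂ s = X₁ - s - c₂ s c₂`. Draw `X₂` as cup, crossing,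
cap. The outer crossings move inside the cup and the cap, and the braid relation turns `s₁ s₂ s₁`
into `s₂ s₁ s₂`. Now a crossing touches the cup and another touches the cap; they become `t'` and
`t` (`cross_comp_cupPQ`, `capPQ_comp_cross`), and `s₁` slides out from between them. Expanding `t
t'` gives three terms: the identity leaves `X₁`, the cup-cap term straightens to `s`, and the dotted
cup-cap term straightens to `c₂ s c₂`.

Composing this with `s` on the left or on the right, and using `s² = 1` and dot slides, gives the
two relations between `T` and `X`. They differ in the sign of the dotted term because one side
produces `c₁ c₂` and the other `c₂ c₁ = -c₁ c₂`.

For `C` and `X` on one strand, the dot travels once around the loop and picks up a single sign, at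
the clockwise cup (`dot_comp_curl`). On different strands only the super interchange law and the
evenness of the curl are needed (`whisk_exchange`, `place_comm`). -/

namespace TwistedHeisenberg

open Strand

namespace DHom

variable {k : Type u} [CommRing k]

/-- The identity morphism of a word. -/
abbrev idm (k : Type u) [CommRing k] (a : Word) : DHom k a a := mk (.id a)

theorem sound {a b : Word} {f g : Diagram k a b} (h : Diagram.Rel f g) : mk f = mk g :=
  Quotient.sound h

/-! ### Vertical composition on the quotient. -/

section Category

variable {a b c d : Word}

theorem id_comp (f : DHom k a b) : comp (idm k b) f = f := by
  obtain ⟨f⟩ := f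
  exact sound (.id_comp f)

theorem comp_id (f : DHom k a b) : comp f (idm k a) = f := by
  obtain ⟨f⟩ := f
  exact sound (.comp_id f)

theorem comp_assoc (h : DHom k c d) (g : DHom k b c) (f : DHom k a b) :
    comp (comp h g) f = comp h (comp g f) := by
  obtain ⟨h⟩ := h
  obtain ⟨g⟩ := g
  obtain ⟨f⟩ := f
  exact sound (.comp_assoc h g f)

theorem add_comp (g g' : DHom k b c) (f : DHom k a b) :
    comp (g + g') f = comp g f + comp g' f := by
  obtain ⟨g⟩ := g
  obtain ⟨g'⟩ := g'
  obtain ⟨f⟩ := f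
  exact sound (.sum_comp g g' f)

theorem comp_add (g : DHom k b c) (f f' : DHom k a b) :
    comp g (f + f') = comp g f + comp g f' := by
  obtain ⟨g⟩ := g
  obtain ⟨f⟩ := f
  obtain ⟨f'⟩ := f'
  exact sound (.comp_sum g f f')

theorem smul_comp (r : k) (g : DHom k b c) (f : DHom k a b) :
    comp (r • g) f = r • comp g f := by
  obtain ⟨g⟩ := g
  obtain ⟨f⟩ := f
  exact sound (.smul_comp r g f)

theorem comp_smul (r : k) (g : DHom k b c) (f : DHom k a b) :
    comp g (r • f) = r • comp g f := by
  obtain ⟨g⟩ := g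
  obtain ⟨f⟩ := f
  exact sound (.comp_smul r g f)

/-- Precompose an equation between composites with a common lower part. -/
theorem comp_eq_assoc {c' : Word} {g : DHom k b c} {f : DHom k a b} {g' : DHom k c' c}
    {f' : DHom k a c'} (h : comp g f = comp g' f') (e : DHom k d a) :
    comp g (comp f e) = comp g' (comp f' e) := by
  rw [← comp_assoc, h, comp_assoc]

end Category

/-! ### Horizontal juxtaposition and the super interchange law. -/

section Tensor

variable {a b c d s t : Word}

theorem id_tensor_id (hs hs' : s = a ++ b) :
    tensor (idm k a) (idm k b) hs hs' = idm k s :=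
  sound (.id_tensor_id hs hs')

theorem unit_tensor (f : DHom k a b) (hs : a = [] ++ a) (ht : b = [] ++ b) :
    tensor (idm k []) f hs ht = f := by
  obtain ⟨f⟩ := f
  exact sound (.unit_tensor f hs ht)

theorem tensor_unit (f : DHom k a b) (hs : a = a ++ []) (ht : b = b ++ []) :
    tensor f (idm k []) hs ht = f := by
  obtain ⟨f⟩ := f
  exact sound (.tensor_unit f hs ht)

theorem tensor_assoc {a b c a' b' c' ab ab' bc bc' s t : Word}
    (f : DHom k a a') (g : DHom k b b') (h : DHom k c c')
    (h₁ : ab = a ++ b) (h₁' : ab' = a' ++ b') (h₂ : s = ab ++ c) (h₂' : t = ab' ++ c')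
    (h₃ : bc = b ++ c) (h₃' : bc' = b' ++ c') (h₄ : s = a ++ bc) (h₄' : t = a' ++ bc') :
    tensor (tensor f g h₁ h₁') h h₂ h₂' = tensor f (tensor g h h₃ h₃') h₄ h₄' := by
  obtain ⟨f⟩ := f
  obtain ⟨g⟩ := g
  obtain ⟨h⟩ := h
  exact sound (.tensor_assoc f g h h₁ h₁' h₂ h₂' h₃ h₃' h₄ h₄')

theorem add_tensor (f f' : DHom k a b) (g : DHom k c d) (hs : s = a ++ c) (ht : t = b ++ d) :
    tensor (f + f') g hs ht = tensor f g hs ht + tensor f' g hs ht := by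
  obtain ⟨f⟩ := f
  obtain ⟨f'⟩ := f'
  obtain ⟨g⟩ := g
  exact sound (.sum_tensor f f' g hs ht)

theorem tensor_add (f : DHom k a b) (g g' : DHom k c d) (hs : s = a ++ c) (ht : t = b ++ d) :
    tensor f (g + g') hs ht = tensor f g hs ht + tensor f g' hs ht := by
  obtain ⟨f⟩ := f
  obtain ⟨g⟩ := g
  obtain ⟨g'⟩ := g'
  exact sound (.tensor_sum f g g' hs ht)

theorem smul_tensor (r : k) (f : DHom k a b) (g : DHom k c d) (hs : s = a ++ c)
    (ht : t = b ++ d) : tensor (r • f) g hs ht = r • tensor f g hs ht := by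
  obtain ⟨f⟩ := f
  obtain ⟨g⟩ := g
  exact sound (.smul_tensor r f g hs ht)

theorem tensor_smul (r : k) (f : DHom k a b) (g : DHom k c d) (hs : s = a ++ c)
    (ht : t = b ++ d) : tensor f (r • g) hs ht = r • tensor f g hs ht := by
  obtain ⟨f⟩ := f
  obtain ⟨g⟩ := g
  exact sound (.tensor_smul r f g hs ht)

/-- The super interchange law. -/
theorem interchange {a b c a' b' c' s t w : Word} {g : DHom k b c} {f : DHom k a b}
    {g' : DHom k b' c'} {f' : DHom k a' b'} {p q : ZMod 2}
    (hs : s = a ++ a') (ht : t = b ++ b') (hw : w = c ++ c')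
    (hg' : HasParity g' p) (hf : HasParity f q) :
    comp (tensor g g' ht hw) (tensor f f' hs ht) =
      ((-1 : k) ^ (p.val * q.val)) • tensor (comp g f) (comp g' f') hs hw := by
  obtain ⟨g', hg', rfl⟩ := hg'
  obtain ⟨f, hf, rfl⟩ := hf
  obtain ⟨g⟩ := g
  obtain ⟨f'⟩ := f'
  exact sound (.interchange hs ht hw hg' hf)

end Tensor

/-! ### Parity, and interchange with identity strands. -/

section Parity

variable {a b c d s t : Word}

theorem hasParity_id (a : Word) : HasParity (idm k a) 0 := ⟨_, .id a, rfl⟩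

theorem hasParity_gen {g : Generator a b} : HasParity (mk (k := k) (.gen g)) g.parity :=
  ⟨_, .gen g, rfl⟩

theorem HasParity.add {f g : DHom k a b} {p : ZMod 2} (hf : HasParity f p)
    (hg : HasParity g p) : HasParity (f + g) p := by
  obtain ⟨f, hf, rfl⟩ := hf
  obtain ⟨g, hg, rfl⟩ := hg
  exact ⟨_, .sum hf hg, rfl⟩

theorem HasParity.smul (r : k) {f : DHom k a b} {p : ZMod 2} (hf : HasParity f p) :
    HasParity (r • f) p := by
  obtain ⟨f, hf, rfl⟩ := hf
  exact ⟨_, .smul r hf, rfl⟩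

theorem HasParity.comp {g : DHom k b c} {f : DHom k a b} {p q : ZMod 2} (hg : HasParity g p)
    (hf : HasParity f q) : HasParity (comp g f) (p + q) := by
  obtain ⟨g, hg, rfl⟩ := hg
  obtain ⟨f, hf, rfl⟩ := hf
  exact ⟨_, .comp hg hf, rfl⟩

theorem HasParity.tensor {f : DHom k a b} {g : DHom k c d} {p q : ZMod 2} (hf : HasParity f p)
    (hg : HasParity g q) (hs : s = a ++ c) (ht : t = b ++ d) :
    HasParity (tensor f g hs ht) (p + q) := by
  obtain ⟨f, hf, rfl⟩ := hf
  obtain ⟨g, hg, rfl⟩ := hg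
  exact ⟨_, .tensor hf hg, rfl⟩

theorem hasParity_zero (p : ZMod 2) : HasParity (0 : DHom k a b) p := ⟨_, .zero a b p, rfl⟩

/-- Every morphism is the sum of an even and an odd one. -/
theorem exists_eq_even_add_odd (f : DHom k a b) :
    ∃ f₀ f₁ : DHom k a b, HasParity f₀ 0 ∧ HasParity f₁ 1 ∧ f = f₀ + f₁ := by
  -- Zero is homogeneous of both parities, so it serves as the missing component.
  have homogeneous {a b : Word} {f : DHom k a b} {p : ZMod 2} (hf : HasParity f p) :
      ∃ f₀ f₁ : DHom k a b, HasParity f₀ 0 ∧ HasParity f₁ 1 ∧ f = f₀ + f₁ := by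
    obtain rfl | rfl : p = 0 ∨ p = 1 := by
      clear hf
      revert p
      decide
    · exact ⟨f, 0, hf, hasParity_zero 1, (add_zero f).symm⟩
    · exact ⟨0, f, hasParity_zero 0, hf, (zero_add f).symm⟩
  obtain ⟨F, rfl⟩ : ∃ F, mk F = f := Quotient.exists_rep f
  induction F with
  | gen g => exact homogeneous hasParity_gen
  | id a => exact homogeneous (hasParity_id a)
  | zero a b => exact homogeneous (hasParity_zero 0)
  | comp g f ihg ihf =>
    obtain ⟨g₀, g₁, hg₀, hg₁, hg⟩ := ihg
    obtain ⟨f₀, f₁, hf₀, hf₁, hf⟩ := ihf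
    refine ⟨DHom.comp g₀ f₀ + DHom.comp g₁ f₁, DHom.comp g₀ f₁ + DHom.comp g₁ f₀,
      (hg₀.comp hf₀).add (hg₁.comp hf₁), (hg₀.comp hf₁).add (hg₁.comp hf₀), ?_⟩
    change DHom.comp (mk g) (mk f) = _
    rw [hg, hf, add_comp, comp_add, comp_add]
    abel
  | tensor f g hs ht ihf ihg =>
    obtain ⟨g₀, g₁, hg₀, hg₁, hg⟩ := ihg
    obtain ⟨f₀, f₁, hf₀, hf₁, hf⟩ := ihf
    refine ⟨DHom.tensor f₀ g₀ hs ht + DHom.tensor f₁ g₁ hs ht,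
      DHom.tensor f₀ g₁ hs ht + DHom.tensor f₁ g₀ hs ht,
      (hf₀.tensor hg₀ hs ht).add (hf₁.tensor hg₁ hs ht),
      (hf₀.tensor hg₁ hs ht).add (hf₁.tensor hg₀ hs ht), ?_⟩
    change DHom.tensor (mk f) (mk g) hs ht = _
    rw [hg, hf, add_tensor, tensor_add, tensor_add]
    abel
  | sum f g ihf ihg =>
    obtain ⟨g₀, g₁, hg₀, hg₁, hg⟩ := ihg
    obtain ⟨f₀, f₁, hf₀, hf₁, hf⟩ := ihf
    refine ⟨f₀ + g₀, f₁ + g₁, hf₀.add hg₀, hf₁.add hg₁, ?_⟩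
    change mk f + mk g = _
    rw [hg, hf]
    abel
  | smul r f ihf =>
    obtain ⟨f₀, f₁, hf₀, hf₁, hf⟩ := ihf
    refine ⟨r • f₀, r • f₁, hf₀.smul r, hf₁.smul r, ?_⟩
    change r • mk f = _
    rw [hf, smul_add]

/-- The interchange law asks for homogeneous inner factors. The identity is one of them and is even,
so splitting the other into its even and odd components makes both signs trivial. The same argument
gives `comp_id_tensor`. -/
theorem comp_tensor_id (g : DHom k b c) (f : DHom k a b) (hs : s = a ++ d) (ht : t = b ++ d)
    {w : Word} (hw : w = c ++ d) :
    comp (tensor g (idm k d) ht hw) (tensor f (idm k d) hs ht) =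
      tensor (comp g f) (idm k d) hs hw := by
  obtain ⟨f₀, f₁, hf₀, hf₁, rfl⟩ := exists_eq_even_add_odd f
  simp only [add_tensor, comp_add]
  rw [interchange hs ht hw (hasParity_id d) hf₀, interchange hs ht hw (hasParity_id d) hf₁]
  simp [id_comp]

theorem comp_id_tensor (g : DHom k b c) (f : DHom k a b) (hs : s = d ++ a) (ht : t = d ++ b)
    {w : Word} (hw : w = d ++ c) :
    comp (tensor (idm k d) g ht hw) (tensor (idm k d) f hs ht) =
      tensor (idm k d) (comp g f) hs hw := by
  obtain ⟨g₀, g₁, hg₀, hg₁, rfl⟩ := exists_eq_even_add_odd g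
  simp only [tensor_add, add_comp]
  rw [interchange hs ht hw hg₀ (hasParity_id d), interchange hs ht hw hg₁ (hasParity_id d)]
  simp [id_comp]

end Parity

/-! ### Whiskering with identities on both sides -/

section Whisk

variable {a b c d s t w : Word}

/-- `id_u ⊗ f ⊗ id_v`. -/
def whisk (u v : Word) (f : DHom k a b) (hs : s = u ++ (a ++ v)) (ht : t = u ++ (b ++ v)) :
    DHom k s t :=
  tensor (idm k u) (tensor f (idm k v) rfl rfl) hs ht

theorem whisk_comp (u v : Word) (g : DHom k b c) (f : DHom k a b) (hs : s = u ++ (a ++ v))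
    (ht : t = u ++ (b ++ v)) (hw : w = u ++ (c ++ v)) :
    whisk u v (comp g f) hs hw = comp (whisk u v g ht hw) (whisk u v f hs ht) := by
  rw [whisk, whisk, whisk, comp_id_tensor, comp_tensor_id]

theorem whisk_add (u v : Word) (f g : DHom k a b) (hs : s = u ++ (a ++ v))
    (ht : t = u ++ (b ++ v)) :
    whisk u v (f + g) hs ht = whisk u v f hs ht + whisk u v g hs ht := by
  rw [whisk, add_tensor, tensor_add]
  rfl

theorem whisk_smul (u v : Word) (r : k) (f : DHom k a b) (hs : s = u ++ (a ++ v))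
    (ht : t = u ++ (b ++ v)) : whisk u v (r • f) hs ht = r • whisk u v f hs ht := by
  rw [whisk, smul_tensor, tensor_smul]
  rfl

theorem whisk_id (u v : Word) (hs hs' : s = u ++ (a ++ v)) :
    whisk u v (idm k a) hs hs' = idm k s := by
  rw [whisk, id_tensor_id, id_tensor_id]

/-- Removes the empty whiskers that appear when one factor of an exchange occupies the full width on
one side of the composite. -/
theorem whisk_nil_nil (f : DHom k a b) (hs : a = [] ++ (a ++ [])) (ht : b = [] ++ (b ++ [])) :
    whisk [] [] f hs ht = f := by
  have assoc := tensor_assoc (idm k []) f (idm k []) rfl rfl hs ht rfl rfl hs ht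
  rw [whisk, ← assoc]
  rw [unit_tensor, tensor_unit]

theorem tensor_id_eq_whisk (v : Word) (f : DHom k a b) (hs : s = a ++ v) (ht : t = b ++ v) :
    tensor f (idm k v) hs ht = whisk [] v f hs ht := by
  subst hs ht
  rw [whisk, unit_tensor]

theorem id_tensor_eq_whisk (u : Word) (f : DHom k a b) (hs : s = u ++ a) (ht : t = u ++ b) :
    tensor (idm k u) f hs ht = whisk u [] f (by simpa using hs) (by simpa using ht) := by
  rw [whisk, ← tensor_assoc (idm k u) f (idm k []) hs ht (by simp) (by simp), tensor_unit]

/-- Associativity merges the identities on each side. The outer words `U` and `V` are free up to an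
equation, so that they can be given as literal words or as powers of `P`. -/
theorem whisk_whisk {u v u' v' U V : Word} (f : DHom k a b) (hs : s = u' ++ (a ++ v'))
    (ht : t = u' ++ (b ++ v')) {s' t' : Word} (hs' : s' = u ++ (s ++ v))
    (ht' : t' = u ++ (t ++ v)) (hU : U = u ++ u') (hV : V = v' ++ v) :
    whisk u v (whisk u' v' f hs ht) hs' ht' =
      whisk U V f (by simp [hs', hs, hU, hV]) (by simp [ht', ht, hU, hV]) := by
  subst hs ht hU hV
  unfold whisk
  rw [tensor_assoc (idm k u') (tensor f (idm k v') rfl rfl) (idm k v) rfl rfl rfl rfl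
      (List.append_assoc a v' v).symm (List.append_assoc b v' v).symm (by simp) (by simp),
    tensor_assoc f (idm k v') (idm k v) rfl rfl _ _ rfl rfl rfl rfl,
    -- The right-hand identities are merged, while the identity on `u ++ u'` is split to match the
    -- left-hand nesting.
    id_tensor_id,  ← id_tensor_id (k := k) (a := u) (b := u') rfl rfl,
    tensor_assoc (idm k u) (idm k u') _ rfl rfl (by simp [hs']) (by simp [ht']) (by simp)
      (by simp) hs' ht']

theorem HasParity.whisk (u v : Word) {f : DHom k a b} {p : ZMod 2} (hf : HasParity f p)
    (hs : s = u ++ (a ++ v)) (ht : t = u ++ (b ++ v)) : HasParity (whisk u v f hs ht) p := by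
  simpa [DHom.whisk] using (hasParity_id u).tensor (hf.tensor (hasParity_id v) rfl rfl) hs ht

/-- Both composites equal `f ⊗ g` by interchange; only the order in which `f` lies below `g` costs
the sign. -/
theorem tensor_exchange {f : DHom k a b} {g : DHom k c d} {p q : ZMod 2} (hf : HasParity f p)
    (hg : HasParity g q) {s₁ s₂ : Word} (hs : s = a ++ c) (ht : t = b ++ d) (h₁ : s₁ = a ++ d)
    (h₂ : s₂ = b ++ c) :
    comp (tensor (idm k b) g h₂ ht) (tensor f (idm k c) hs h₂) =
      ((-1 : k) ^ (p.val * q.val)) •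
        comp (tensor f (idm k d) h₁ ht) (tensor (idm k a) g hs h₁) := by
  rw [interchange _ _ _ hg hf, interchange _ _ _ (hasParity_id d) (hasParity_id a), id_comp,
    id_comp, comp_id, comp_id, mul_comm]
  simp

/-- Morphisms on disjoint sets of strands supercommute. -/
theorem whisk_exchange {u m v ul vr ul' vr' s₁ s₂ : Word} {f : DHom k a b} {g : DHom k c d}
    {p q : ZMod 2} (hf : HasParity f p) (hg : HasParity g q)
    (hs₂ : s₂ = ul ++ (c ++ v)) (ht₂ : t = ul ++ (d ++ v))
    (hs : s = u ++ (a ++ vr)) (h₂ : s₂ = u ++ (b ++ vr))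
    (h₁ : s₁ = u ++ (a ++ vr')) (ht : t = u ++ (b ++ vr'))
    (hs' : s = ul' ++ (c ++ v)) (h₁' : s₁ = ul' ++ (d ++ v))
    (hul : ul = u ++ (b ++ m)) (hul' : ul' = u ++ (a ++ m))
    (hvr : vr = m ++ (c ++ v)) (hvr' : vr' = m ++ (d ++ v)) :
    comp (whisk ul v g hs₂ ht₂) (whisk u vr f hs h₂) =
      ((-1 : k) ^ (p.val * q.val)) •
        comp (whisk u vr' f h₁ ht) (whisk ul' v g hs' h₁') := by
  subst hul hul' hvr hvr'
  -- Factoring off `u` and `x` exhibits `g`, padded by `m` and `v`, as the right neighbour of the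
  -- block `x`. For `x = a` and `x = b` this reduces the claim to `tensor_exchange`.
  have key (x : Word) {s s' : Word} (h : s = (u ++ (x ++ m)) ++ (c ++ v))
      (h' : s' = (u ++ (x ++ m)) ++ (d ++ v)) :
      whisk (u ++ (x ++ m)) v g h h' =
        tensor (idm k u) (tensor (idm k x) (whisk m v g rfl rfl) rfl rfl)
          (by simpa using h) (by simpa using h') := by
    have hx : tensor (idm k x) (whisk m v g rfl rfl) rfl rfl =
        whisk (x ++ m) v g (by simp) (by simp) := by
      rw [id_tensor_eq_whisk, whisk_whisk (V := v) _ _ _ _ _ rfl (by simp)]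
    rw [hx, id_tensor_eq_whisk, whisk_whisk (V := v) _ _ _ _ _ rfl (by simp)]
  rw [key, key]
  rw [whisk.eq_def u _ f, whisk.eq_def u _ f, comp_id_tensor, comp_id_tensor,
    tensor_exchange hf (hg.whisk m v rfl rfl) rfl rfl rfl rfl, tensor_smul]

end Whisk

/-- The sign-free case of `whisk_exchange`. For generators on explicit words the parity and word
conditions hold by computation, hence the `rfl` defaults. -/
theorem whisk_comm {a b c d s t : Word} (u m v : Word)
    {ul vr ul' vr' s₁ s₂ : Word} {f : DHom k a b} {g : DHom k c d} {p q : ZMod 2}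
    {hs₂ : s₂ = ul ++ (c ++ v)} {ht₂ : t = ul ++ (d ++ v)}
    {hs : s = u ++ (a ++ vr)} {h₂ : s₂ = u ++ (b ++ vr)}
    {h₁ : s₁ = u ++ (a ++ vr')} {ht : t = u ++ (b ++ vr')}
    {hs' : s = ul' ++ (c ++ v)} {h₁' : s₁ = ul' ++ (d ++ v)}
    (hf : HasParity f p) (hg : HasParity g q) (hpq : p.val * q.val = 0 := by rfl)
    (hul : ul = u ++ (b ++ m) := by rfl) (hul' : ul' = u ++ (a ++ m) := by rfl)
    (hvr : vr = m ++ (c ++ v) := by rfl) (hvr' : vr' = m ++ (d ++ v) := by rfl) :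
    comp (whisk ul v g hs₂ ht₂) (whisk u vr f hs h₂) =
      comp (whisk u vr' f h₁ ht) (whisk ul' v g hs' h₁') := by
  rw [whisk_exchange hf hg hs₂ ht₂ hs h₂ h₁ ht hs' h₁' hul hul' hvr hvr', hpq, pow_zero, one_smul]

/-- A form of `whisk_whisk` with all resulting words determined by the left side, so that it can be
used by `simp`; `whisk_comp_append` does the same for `whisk_comp`. -/
theorem whisk_whisk_append {a b s t s' t' u v u' v' : Word}
    (f : DHom k a b) (hs : s = u' ++ (a ++ v')) (ht : t = u' ++ (b ++ v'))
    (hs' : s' = u ++ (s ++ v)) (ht' : t' = u ++ (t ++ v)) :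
    whisk u v (whisk u' v' f hs ht) hs' ht' =
      whisk (u ++ u') (v' ++ v) f (by simp [hs', hs]) (by simp [ht', ht]) :=
  whisk_whisk f hs ht hs' ht' rfl rfl

theorem whisk_comp_append {a b c s w u v : Word} (g : DHom k b c)
    (f : DHom k a b) (hs : s = u ++ (a ++ v)) (hw : w = u ++ (c ++ v)) :
    whisk u v (comp g f) hs hw = comp (whisk u v g rfl hw) (whisk u v f hs rfl) :=
  whisk_comp u v g f hs rfl hw

theorem comp_eq_id_assoc {a b c : Word} {g : DHom k b c}
    {f : DHom k c b} (h : comp g f = idm k c) (e : DHom k a c) : comp g (comp f e) = e := by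
  rw [← comp_assoc, h, id_comp]

/-- Applies a local relation inside a wider diagram. -/
theorem comp_whisk_congr {a b b' c s t t' w : Word} (u v : Word)
    {g : DHom k b c} {f : DHom k a b} {g' : DHom k b' c} {f' : DHom k a b'}
    (h : comp g f = comp g' f') (hs : s = u ++ (a ++ v)) (ht : t = u ++ (b ++ v))
    (ht' : t' = u ++ (b' ++ v)) (hw : w = u ++ (c ++ v)) :
    comp (whisk u v g ht hw) (whisk u v f hs ht) =
      comp (whisk u v g' ht' hw) (whisk u v f' hs ht') := by
  rw [← whisk_comp, h, whisk_comp]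

/-! ### The generators and their defining relations in whiskered form. -/

section Generators

variable (k)

/-- The crossing of two upward strands. -/
abbrev cross : DHom k [P, P] [P, P] := mk (Diagram.cross k)
/-- The counterclockwise cap. -/
abbrev capQP : DHom k [Q, P] [] := mk (Diagram.capQP k)
/-- The counterclockwise cup. -/
abbrev cupQP : DHom k [] [Q, P] := mk (Diagram.cupQP k)
/-- The clockwise cap. -/
abbrev capPQ : DHom k [P, Q] [] := mk (Diagram.capPQ k)
/-- The clockwise cup. -/
abbrev cupPQ : DHom k [] [P, Q] := mk (Diagram.cupPQ k)
/-- The hollow dot on an upward strand. -/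
abbrev dotP : DHom k [P] [P] := mk (Diagram.dotP k)
/-- The hollow dot on a downward strand. -/
abbrev dotQ : DHom k [Q] [Q] := mk (Diagram.dotQ k)
/-- The sideways crossing `PQ ⟶ QP`. -/
abbrev crossPQ : DHom k [P, Q] [Q, P] := mk (Diagram.crossPQ k)
/-- The sideways crossing `QP ⟶ PQ`. -/
abbrev crossQP : DHom k [Q, P] [P, Q] := mk (Diagram.crossQP k)
/-- The right curl on an upward strand. -/
abbrev curl : DHom k [P] [P] := mk (Diagram.curl k)

/-- The triple tensor in the diagram is bracketed to the left and `whisk` brackets to the right,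
which is why associativity enters; likewise in `crossQP_eq`. -/
theorem crossPQ_eq : crossPQ k =
    comp (whisk [Q, P] [] (capPQ k) rfl rfl : DHom k [Q, P, P, Q] [Q, P])
      (comp (whisk [Q] [Q] (cross k) rfl rfl : DHom k [Q, P, P, Q] [Q, P, P, Q])
        (whisk [] [P, Q] (cupQP k) rfl rfl : DHom k [P, Q] [Q, P, P, Q])) := by
  rw [← id_tensor_eq_whisk (s := [Q, P, P, Q]) (t := [Q, P]) _ _ rfl rfl,
    ← tensor_id_eq_whisk (s := [P, Q]) (t := [Q, P, P, Q]) _ _ rfl rfl,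
    whisk, ← tensor_assoc (idm k [Q]) (cross k) (idm k [Q]) rfl rfl rfl rfl]
  rfl

theorem crossQP_eq : crossQP k =
    comp (whisk [] [P, Q] (capQP k) rfl rfl : DHom k [Q, P, P, Q] [P, Q])
      (comp (whisk [Q] [Q] (cross k) rfl rfl : DHom k [Q, P, P, Q] [Q, P, P, Q])
        (whisk [Q, P] [] (cupPQ k) rfl rfl : DHom k [Q, P] [Q, P, P, Q])) := by
  rw [← id_tensor_eq_whisk (s := [Q, P]) (t := [Q, P, P, Q]) _ _ rfl rfl,
    ← tensor_id_eq_whisk (s := [Q, P, P, Q]) (t := [P, Q]) _ _ rfl rfl,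
    whisk, ← tensor_assoc (idm k [Q]) (cross k) (idm k [Q]) rfl rfl rfl rfl]
  rfl

theorem curl_eq : curl k =
    comp (whisk [P] [] (capPQ k) rfl rfl : DHom k [P, P, Q] [P])
      (comp (whisk [] [Q] (cross k) rfl rfl : DHom k [P, P, Q] [P, P, Q])
        (whisk [P] [] (cupPQ k) rfl rfl : DHom k [P] [P, P, Q])) := by
  rw [← id_tensor_eq_whisk (s := [P, P, Q]) (t := [P]) _ _ rfl rfl,
    ← tensor_id_eq_whisk (s := [P, P, Q]) (t := [P, P, Q]) _ _ rfl rfl,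
    ← id_tensor_eq_whisk (s := [P]) (t := [P, P, Q]) _ _ rfl rfl]
  rfl

theorem hasParity_curl : HasParity (curl k) 0 := by
  have hcap : HasParity (capPQ k) 0 := hasParity_gen
  have hcup : HasParity (cupPQ k) 0 := hasParity_gen
  have hcross : HasParity (cross k) 0 := hasParity_gen
  rw [curl_eq]
  simpa using (hcap.whisk _ _ _ _).comp ((hcross.whisk _ _ _ _).comp (hcup.whisk _ _ _ _))

theorem hasParity_crossQP : HasParity (crossQP k) 0 := by
  have hcap : HasParity (capQP k) 0 := hasParity_gen
  have hcup : HasParity (cupPQ k) 0 := hasParity_gen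
  have hcross : HasParity (cross k) 0 := hasParity_gen
  rw [crossQP_eq]
  simpa using (hcap.whisk _ _ _ _).comp ((hcross.whisk _ _ _ _).comp (hcup.whisk _ _ _ _))

theorem zigzag_cupPQ_capQP :
    comp (whisk [P] [] (capQP k) rfl rfl : DHom k [P, Q, P] [P]) (whisk [] [P] (cupPQ k) rfl rfl
      : DHom k [P] [P, Q, P]) =
      idm k [P] := by
  rw [← id_tensor_eq_whisk (s := [P, Q, P]) (t := [P]) _ _ rfl rfl,
    ← tensor_id_eq_whisk (s := [P]) (t := [P, Q, P]) _ _ rfl rfl]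
  exact sound .zigzag₁

theorem zigzag_cupQP_capPQ :
    comp (whisk [] [P] (capPQ k) rfl rfl : DHom k [P, Q, P] [P]) (whisk [P] [] (cupQP k) rfl rfl
      : DHom k [P] [P, Q, P]) =
      idm k [P] := by
  rw [← tensor_id_eq_whisk (s := [P, Q, P]) (t := [P]) _ _ rfl rfl,
    ← id_tensor_eq_whisk (s := [P]) (t := [P, Q, P]) _ _ rfl rfl]
  exact sound .zigzag₂

theorem cross_comp_cross : comp (cross k) (cross k) = idm k [P, P] := sound .cross_cross

theorem cross_braid :
    comp (whisk [] [P] (cross k) rfl rfl : DHom k [P, P, P] [P, P, P])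
      (comp (whisk [P] [] (cross k) rfl rfl : DHom k [P, P, P] [P, P, P])
        (whisk [] [P] (cross k) rfl rfl : DHom k [P, P, P] [P, P, P])) =
    comp (whisk [P] [] (cross k) rfl rfl : DHom k [P, P, P] [P, P, P]) (comp
      (whisk [] [P] (cross k) rfl rfl : DHom k [P, P, P] [P, P, P])
        (whisk [P] [] (cross k) rfl rfl : DHom k [P, P, P] [P, P, P])) := by
  rw [← tensor_id_eq_whisk (s := [P, P, P]) (t := [P, P, P]) _ _ rfl rfl,
    ← id_tensor_eq_whisk (s := [P, P, P]) (t := [P, P, P]) _ _ rfl rfl]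
  exact sound .braid

theorem dot_comp_cross :
    comp (whisk [] [P] (dotP k) rfl rfl : DHom k [P, P] [P, P]) (cross k) =
      comp (cross k) (whisk [P] [] (dotP k) rfl rfl : DHom k [P, P] [P, P]) := by
  rw [← tensor_id_eq_whisk (s := [P, P]) (t := [P, P]) _ _ rfl rfl,
    ← id_tensor_eq_whisk (s := [P, P]) (t := [P, P]) _ _ rfl rfl]
  exact sound .cross_dot

theorem cross_comp_dot :
    comp (cross k) (whisk [] [P] (dotP k) rfl rfl : DHom k [P, P] [P, P]) =
      comp (whisk [P] [] (dotP k) rfl rfl : DHom k [P, P] [P, P]) (cross k) := by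
  rw [← tensor_id_eq_whisk (s := [P, P]) (t := [P, P]) _ _ rfl rfl,
    ← id_tensor_eq_whisk (s := [P, P]) (t := [P, P]) _ _ rfl rfl]
  exact sound .dot_cross

theorem capPQ_comp_dot :
    comp (capPQ k) (whisk [] [Q] (dotP k) rfl rfl : DHom k [P, Q] [P, Q]) =
      comp (capPQ k) (whisk [P] [] (dotQ k) rfl rfl : DHom k [P, Q] [P, Q]) := by
  rw [← tensor_id_eq_whisk (s := [P, Q]) (t := [P, Q]) _ _ rfl rfl,
    ← id_tensor_eq_whisk (s := [P, Q]) (t := [P, Q]) _ _ rfl rfl]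
  exact sound .dot_capPQ

theorem dot_comp_cupPQ :
    comp (whisk [] [Q] (dotP k) rfl rfl : DHom k [P, Q] [P, Q]) (cupPQ k) =
      (-1 : k) • comp (whisk [P] [] (dotQ k) rfl rfl : DHom k [P, Q] [P, Q]) (cupPQ k) := by
  rw [← tensor_id_eq_whisk (s := [P, Q]) (t := [P, Q]) _ _ rfl rfl,
    ← id_tensor_eq_whisk (s := [P, Q]) (t := [P, Q]) _ _ rfl rfl]
  exact sound .dot_cupPQ

theorem dot_comp_cupQP :
    comp (whisk [] [P] (dotQ k) rfl rfl : DHom k [Q, P] [Q, P]) (cupQP k) =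
      comp (whisk [Q] [] (dotP k) rfl rfl : DHom k [Q, P] [Q, P]) (cupQP k) := by
  rw [← tensor_id_eq_whisk (s := [Q, P]) (t := [Q, P]) _ _ rfl rfl,
    ← id_tensor_eq_whisk (s := [Q, P]) (t := [Q, P]) _ _ rfl rfl]
  exact sound .dot_cupQP

/-- The dot on the cup is moved from the downward to the upward strand, so that both dots end up on
ends that survive the later zigzags. -/
theorem crossPQ_comp_crossQP :
    comp (crossPQ k) (crossQP k) =
      idm k [Q, P] + (-1 : k) • comp (cupQP k) (capQP k) +
        (-1 : k) • comp (whisk [Q] [] (dotP k) rfl rfl : DHom k [Q, P] [Q, P]) (comp (cupQP k)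
          (comp (capQP k) (whisk [Q] [] (dotP k) rfl rfl : DHom k [Q, P] [Q, P]))) := by
  rw [← comp_assoc _ (cupQP k), ← dot_comp_cupQP,
    ← tensor_id_eq_whisk (s := [Q, P]) (t := [Q, P]) _ _ rfl rfl,
    ← id_tensor_eq_whisk (s := [Q, P]) (t := [Q, P]) _ _ rfl rfl]
  exact sound .cross_QP

/-! ### The curl -/

/-- A cup slides under an upward strand. -/
theorem cross_comp_cupPQ :
    comp (whisk [] [Q] (cross k) rfl rfl : DHom k [P, P, Q] [P, P, Q])
        (whisk [P] [] (cupPQ k) rfl rfl : DHom k [P] [P, P, Q]) =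
      comp (whisk [P] [] (crossQP k) rfl rfl : DHom k [P, Q, P] [P, P, Q])
        (whisk [] [P] (cupPQ k) rfl rfl : DHom k [P] [P, Q, P]) := by
  -- The outer cup on the right-hand side moves up past the cup and the crossing inside `crossQP`,
  -- until it cancels against the cap there.
  have expand : (whisk [P] [] (crossQP k) rfl rfl : DHom k [P, Q, P] [P, P, Q]) =
      comp (whisk [P] [P, Q] (capQP k) rfl rfl : DHom k [P, Q, P, P, Q] [P, P, Q])
        (comp (whisk [P, Q] [Q] (cross k) rfl rfl : DHom k [P, Q, P, P, Q] [P, Q, P, P, Q])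
          (whisk [P, Q, P] [] (cupPQ k) rfl rfl : DHom k [P, Q, P] [P, Q, P, P, Q])) := by
    rw [crossQP_eq]
    simp only [whisk_comp_append, whisk_whisk_append]
    rfl
  have cups : comp (whisk [P, Q, P] [] (cupPQ k) rfl rfl : DHom k [P, Q, P] [P, Q, P, P, Q])
        (whisk [] [P] (cupPQ k) rfl rfl : DHom k [P] [P, Q, P]) =
      comp (whisk [] [P, P, Q] (cupPQ k) rfl rfl : DHom k [P, P, Q] [P, Q, P, P, Q])
        (whisk [P] [] (cupPQ k) rfl rfl : DHom k [P] [P, P, Q]) :=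
    whisk_comm [] [P] [] hasParity_gen hasParity_gen
  have slide : comp (whisk [P, Q] [Q] (cross k) rfl rfl : DHom k [P, Q, P, P, Q] [P, Q, P, P, Q])
        (whisk [] [P, P, Q] (cupPQ k) rfl rfl : DHom k [P, P, Q] [P, Q, P, P, Q]) =
      comp (whisk [] [P, P, Q] (cupPQ k) rfl rfl : DHom k [P, P, Q] [P, Q, P, P, Q])
        (whisk [] [Q] (cross k) rfl rfl : DHom k [P, P, Q] [P, P, Q]) :=
    whisk_comm [] [] [Q] hasParity_gen hasParity_gen
  have zigzag : comp (whisk [P] [P, Q] (capQP k) rfl rfl : DHom k [P, Q, P, P, Q] [P, P, Q])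
        (whisk [] [P, P, Q] (cupPQ k) rfl rfl : DHom k [P, P, Q] [P, Q, P, P, Q]) =
      idm k [P, P, Q] := by
    have h := congrArg (fun f => (whisk [] [P, Q] f rfl rfl : DHom k [P, P, Q] [P, P, Q]))
      (zigzag_cupPQ_capQP k)
    simp only [whisk_id, whisk_comp_append, whisk_whisk_append] at h
    exact h
  rw [expand, comp_assoc, comp_assoc, cups, comp_eq_assoc slide, ← comp_assoc, zigzag, id_comp]

/-- A cap slides under an upward strand. -/
theorem capPQ_comp_cross :
    comp (whisk [P] [] (capPQ k) rfl rfl : DHom k [P, P, Q] [P])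
        (whisk [] [Q] (cross k) rfl rfl : DHom k [P, P, Q] [P, P, Q]) =
      comp (whisk [] [P] (capPQ k) rfl rfl : DHom k [P, Q, P] [P])
        (whisk [P] [] (crossPQ k) rfl rfl : DHom k [P, P, Q] [P, Q, P]) := by
  -- The mirror argument: the outer cap moves down until it cancels against the cup inside
  -- `crossPQ`.
  have expand : (whisk [P] [] (crossPQ k) rfl rfl : DHom k [P, P, Q] [P, Q, P]) =
      comp (whisk [P, Q, P] [] (capPQ k) rfl rfl : DHom k [P, Q, P, P, Q] [P, Q, P])
        (comp (whisk [P, Q] [Q] (cross k) rfl rfl : DHom k [P, Q, P, P, Q] [P, Q, P, P, Q])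
          (whisk [P] [P, Q] (cupQP k) rfl rfl : DHom k [P, P, Q] [P, Q, P, P, Q])) := by
    rw [crossPQ_eq]
    simp only [whisk_comp_append, whisk_whisk_append]
    rfl
  have caps : comp (whisk [] [P] (capPQ k) rfl rfl : DHom k [P, Q, P] [P])
        (whisk [P, Q, P] [] (capPQ k) rfl rfl : DHom k [P, Q, P, P, Q] [P, Q, P]) =
      comp (whisk [P] [] (capPQ k) rfl rfl : DHom k [P, P, Q] [P])
        (whisk [] [P, P, Q] (capPQ k) rfl rfl : DHom k [P, Q, P, P, Q] [P, P, Q]) :=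
    (whisk_comm [] [P] [] hasParity_gen hasParity_gen).symm
  have slide : comp (whisk [] [P, P, Q] (capPQ k) rfl rfl : DHom k [P, Q, P, P, Q] [P, P, Q])
        (whisk [P, Q] [Q] (cross k) rfl rfl : DHom k [P, Q, P, P, Q] [P, Q, P, P, Q]) =
      comp (whisk [] [Q] (cross k) rfl rfl : DHom k [P, P, Q] [P, P, Q])
        (whisk [] [P, P, Q] (capPQ k) rfl rfl : DHom k [P, Q, P, P, Q] [P, P, Q]) :=
    (whisk_comm [] [] [Q] hasParity_gen hasParity_gen).symm
  have zigzag : comp (whisk [] [P, P, Q] (capPQ k) rfl rfl : DHom k [P, Q, P, P, Q] [P, P, Q])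
        (whisk [P] [P, Q] (cupQP k) rfl rfl : DHom k [P, P, Q] [P, Q, P, P, Q]) =
      idm k [P, P, Q] := by
    have h := congrArg (fun f => (whisk [] [P, Q] f rfl rfl : DHom k [P, P, Q] [P, P, Q]))
      (zigzag_cupQP_capPQ k)
    simp only [whisk_id, whisk_comp_append, whisk_whisk_append] at h
    exact h
  rw [expand, comp_eq_assoc caps, comp_eq_assoc slide, zigzag, comp_id]

/-- The dot and the curl on an upward strand anticommute. -/
theorem dot_comp_curl : comp (dotP k) (curl k) = (-1 : k) • comp (curl k) (dotP k) := by
  have cap : comp (dotP k) (whisk [P] [] (capPQ k) rfl rfl : DHom k [P, P, Q] [P]) =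
      comp (whisk [P] [] (capPQ k) rfl rfl : DHom k [P, P, Q] [P])
        (whisk [] [P, Q] (dotP k) rfl rfl : DHom k [P, P, Q] [P, P, Q]) := by
    have h : comp (whisk [P] [] (capPQ k) rfl rfl : DHom k [P, P, Q] [P])
      (whisk [] [P, Q] (dotP k) rfl rfl : DHom k [P, P, Q] [P, P, Q]) =
        comp (whisk [] [] (dotP k) rfl rfl : DHom k [P] [P]) (whisk [P] [] (capPQ k) rfl rfl
          : DHom k [P, P, Q] [P]) :=
      whisk_comm [] [] [] hasParity_gen hasParity_gen
    simpa only [whisk_nil_nil] using h.symm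
  have first : comp (whisk [] [P, Q] (dotP k) rfl rfl : DHom k [P, P, Q] [P, P, Q])
        (whisk [] [Q] (cross k) rfl rfl : DHom k [P, P, Q] [P, P, Q]) =
      comp (whisk [] [Q] (cross k) rfl rfl : DHom k [P, P, Q] [P, P, Q])
        (whisk [P] [Q] (dotP k) rfl rfl : DHom k [P, P, Q] [P, P, Q]) := by
    have h := comp_whisk_congr [] [Q] (dot_comp_cross k) rfl rfl rfl rfl
    simp only [whisk_whisk_append] at h
    exact h
  -- The only sign on the dot's way around the loop arises here.
  have cup : comp (whisk [P] [Q] (dotP k) rfl rfl : DHom k [P, P, Q] [P, P, Q])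
        (whisk [P] [] (cupPQ k) rfl rfl : DHom k [P] [P, P, Q]) =
      (-1 : k) • comp (whisk [P, P] [] (dotQ k) rfl rfl : DHom k [P, P, Q] [P, P, Q])
      (whisk [P] [] (cupPQ k) rfl rfl : DHom k [P] [P, P, Q]) := by
    have h := congrArg (fun f => (whisk [P] [] f rfl rfl : DHom k [P] [P, P, Q]))
      (dot_comp_cupPQ k)
    simp only [whisk_smul, whisk_comp_append, whisk_whisk_append] at h
    exact h
  have slide : comp (whisk [] [Q] (cross k) rfl rfl : DHom k [P, P, Q] [P, P, Q])
        (whisk [P, P] [] (dotQ k) rfl rfl : DHom k [P, P, Q] [P, P, Q]) =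
      comp (whisk [P, P] [] (dotQ k) rfl rfl : DHom k [P, P, Q] [P, P, Q])
        (whisk [] [Q] (cross k) rfl rfl : DHom k [P, P, Q] [P, P, Q]) :=
    (whisk_comm [] [] [] hasParity_gen hasParity_gen).symm
  have around : comp (whisk [P] [] (capPQ k) rfl rfl : DHom k [P, P, Q] [P])
        (whisk [P, P] [] (dotQ k) rfl rfl : DHom k [P, P, Q] [P, P, Q]) =
      comp (whisk [P] [] (capPQ k) rfl rfl : DHom k [P, P, Q] [P]) (whisk [P] [Q] (dotP k) rfl rfl
        : DHom k [P, P, Q] [P, P, Q]) := by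
    have h := comp_whisk_congr [P] [] (capPQ_comp_dot k) rfl rfl rfl rfl
    simp only [whisk_whisk_append] at h
    exact h.symm
  have second : comp (whisk [P] [Q] (dotP k) rfl rfl : DHom k [P, P, Q] [P, P, Q])
        (whisk [] [Q] (cross k) rfl rfl : DHom k [P, P, Q] [P, P, Q]) =
      comp (whisk [] [Q] (cross k) rfl rfl : DHom k [P, P, Q] [P, P, Q])
        (whisk [] [P, Q] (dotP k) rfl rfl : DHom k [P, P, Q] [P, P, Q]) := by
    have h := comp_whisk_congr [] [Q] (cross_comp_dot k) rfl rfl rfl rfl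
    simp only [whisk_whisk_append] at h
    exact h.symm
  have bottom : comp (whisk [] [P, Q] (dotP k) rfl rfl : DHom k [P, P, Q] [P, P, Q])
        (whisk [P] [] (cupPQ k) rfl rfl : DHom k [P] [P, P, Q]) = comp
        (whisk [P] [] (cupPQ k) rfl rfl : DHom k [P] [P, P, Q]) (dotP k) := by
    have h : comp (whisk [P] [] (cupPQ k) rfl rfl : DHom k [P] [P, P, Q])
      (whisk [] [] (dotP k) rfl rfl : DHom k [P] [P]) =
        comp (whisk [] [P, Q] (dotP k) rfl rfl : DHom k [P, P, Q] [P, P, Q])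
          (whisk [P] [] (cupPQ k) rfl rfl : DHom k [P] [P, P, Q]) :=
      whisk_comm [] [] [] hasParity_gen hasParity_gen
    simpa only [whisk_nil_nil] using h.symm
  rw [curl_eq, comp_eq_assoc cap, comp_eq_assoc first, cup, comp_smul, comp_smul,
    comp_eq_assoc slide, comp_eq_assoc around, comp_eq_assoc second, bottom, comp_assoc,
    comp_assoc]

/-- Conjugating the curl on the right strand by the crossing. -/
theorem cross_comp_curl_comp_cross :
    comp (cross k) (comp (whisk [P] [] (curl k) rfl rfl : DHom k [P, P] [P, P]) (cross k)) =
      (whisk [] [P] (curl k) rfl rfl : DHom k [P, P] [P, P]) + (-1 : k) • cross k +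
        (-1 : k) • comp (whisk [P] [] (dotP k) rfl rfl : DHom k [P, P] [P, P])
          (comp (cross k) (whisk [P] [] (dotP k) rfl rfl : DHom k [P, P] [P, P])) := by
  have curl_right : (whisk [P] [] (curl k) rfl rfl : DHom k [P, P] [P, P]) =
      comp (whisk [P, P] [] (capPQ k) rfl rfl : DHom k [P, P, P, Q] [P, P])
        (comp (whisk [P] [Q] (cross k) rfl rfl : DHom k [P, P, P, Q] [P, P, P, Q])
          (whisk [P, P] [] (cupPQ k) rfl rfl : DHom k [P, P] [P, P, P, Q])) := by
    rw [curl_eq]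
    simp only [whisk_comp_append, whisk_whisk_append]
    rfl
  have curl_left : (whisk [] [P] (curl k) rfl rfl : DHom k [P, P] [P, P]) =
      comp (whisk [P] [P] (capPQ k) rfl rfl : DHom k [P, P, Q, P] [P, P])
        (comp (whisk [] [Q, P] (cross k) rfl rfl : DHom k [P, P, Q, P] [P, P, Q, P])
          (whisk [P] [P] (cupPQ k) rfl rfl : DHom k [P, P] [P, P, Q, P])) := by
    rw [curl_eq]
    simp only [whisk_comp_append, whisk_whisk_append]
    rfl
  have top : comp (cross k) (whisk [P, P] [] (capPQ k) rfl rfl : DHom k [P, P, P, Q] [P, P]) =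
      comp (whisk [P, P] [] (capPQ k) rfl rfl : DHom k [P, P, P, Q] [P, P])
        (whisk [] [P, Q] (cross k) rfl rfl : DHom k [P, P, P, Q] [P, P, P, Q]) := by
    have h : comp (whisk [P, P] [] (capPQ k) rfl rfl : DHom k [P, P, P, Q] [P, P])
      (whisk [] [P, Q] (cross k) rfl rfl : DHom k [P, P, P, Q] [P, P, P, Q]) =
        comp (whisk [] [] (cross k) rfl rfl : DHom k [P, P] [P, P])
          (whisk [P, P] [] (capPQ k) rfl rfl : DHom k [P, P, P, Q] [P, P]) :=
      whisk_comm [] [] [] hasParity_gen hasParity_gen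
    simpa only [whisk_nil_nil] using h.symm
  have bottom : comp (whisk [P, P] [] (cupPQ k) rfl rfl : DHom k [P, P] [P, P, P, Q]) (cross k) =
      comp (whisk [] [P, Q] (cross k) rfl rfl : DHom k [P, P, P, Q] [P, P, P, Q])
        (whisk [P, P] [] (cupPQ k) rfl rfl : DHom k [P, P] [P, P, P, Q]) := by
    have h : comp (whisk [P, P] [] (cupPQ k) rfl rfl : DHom k [P, P] [P, P, P, Q])
      (whisk [] [] (cross k) rfl rfl : DHom k [P, P] [P, P]) =
        comp (whisk [] [P, Q] (cross k) rfl rfl : DHom k [P, P, P, Q] [P, P, P, Q])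
          (whisk [P, P] [] (cupPQ k) rfl rfl : DHom k [P, P] [P, P, P, Q]) :=
      whisk_comm [] [] [] hasParity_gen hasParity_gen
    simpa only [whisk_nil_nil] using h
  have braid : comp (whisk [] [P, Q] (cross k) rfl rfl : DHom k [P, P, P, Q] [P, P, P, Q])
        (comp (whisk [P] [Q] (cross k) rfl rfl : DHom k [P, P, P, Q] [P, P, P, Q])
          (whisk [] [P, Q] (cross k) rfl rfl : DHom k [P, P, P, Q] [P, P, P, Q])) =
      comp (whisk [P] [Q] (cross k) rfl rfl : DHom k [P, P, P, Q] [P, P, P, Q]) (comp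
        (whisk [] [P, Q] (cross k) rfl rfl : DHom k [P, P, P, Q] [P, P, P, Q])
        (whisk [P] [Q] (cross k) rfl rfl : DHom k [P, P, P, Q] [P, P, P, Q])) := by
    have h := congrArg (fun f => (whisk [] [Q] f rfl rfl : DHom k [P, P, P, Q] [P, P, P, Q]))
      (cross_braid k)
    simp only [whisk_comp_append, whisk_whisk_append] at h
    exact h
  have cap : comp (whisk [P, P] [] (capPQ k) rfl rfl : DHom k [P, P, P, Q] [P, P])
        (whisk [P] [Q] (cross k) rfl rfl : DHom k [P, P, P, Q] [P, P, P, Q]) =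
      comp (whisk [P] [P] (capPQ k) rfl rfl : DHom k [P, P, Q, P] [P, P])
        (whisk [P, P] [] (crossPQ k) rfl rfl : DHom k [P, P, P, Q] [P, P, Q, P]) := by
    have h := comp_whisk_congr [P] [] (capPQ_comp_cross k) rfl rfl rfl rfl
    simp only [whisk_whisk_append] at h
    exact h
  have cup : comp (whisk [P] [Q] (cross k) rfl rfl : DHom k [P, P, P, Q] [P, P, P, Q])
        (whisk [P, P] [] (cupPQ k) rfl rfl : DHom k [P, P] [P, P, P, Q]) =
      comp (whisk [P, P] [] (crossQP k) rfl rfl : DHom k [P, P, Q, P] [P, P, P, Q])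
        (whisk [P] [P] (cupPQ k) rfl rfl : DHom k [P, P] [P, P, Q, P]) := by
    have h := comp_whisk_congr [P] [] (cross_comp_cupPQ k) rfl rfl rfl rfl
    simp only [whisk_whisk_append] at h
    exact h
  -- The middle crossing of the braid and the sideways crossing lie on disjoint strands, so
  -- `crossQP` can move up to meet `crossPQ`.
  have slide : comp (whisk [] [P, Q] (cross k) rfl rfl : DHom k [P, P, P, Q] [P, P, P, Q])
        (whisk [P, P] [] (crossQP k) rfl rfl : DHom k [P, P, Q, P] [P, P, P, Q]) =
      comp (whisk [P, P] [] (crossQP k) rfl rfl : DHom k [P, P, Q, P] [P, P, P, Q])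
        (whisk [] [Q, P] (cross k) rfl rfl : DHom k [P, P, Q, P] [P, P, Q, P]) :=
    (whisk_comm [] [] [] hasParity_gen (hasParity_crossQP k)).symm
  have double : comp (whisk [P, P] [] (crossPQ k) rfl rfl : DHom k [P, P, P, Q] [P, P, Q, P])
        (whisk [P, P] [] (crossQP k) rfl rfl : DHom k [P, P, Q, P] [P, P, P, Q]) =
      idm k [P, P, Q, P] + (-1 : k) • comp (whisk [P, P] [] (cupQP k) rfl rfl
        : DHom k [P, P] [P, P, Q, P])
          (whisk [P, P] [] (capQP k) rfl rfl : DHom k [P, P, Q, P] [P, P]) +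
        (-1 : k) • comp (whisk [P, P, Q] [] (dotP k) rfl rfl : DHom k [P, P, Q, P] [P, P, Q, P])
          (comp (whisk [P, P] [] (cupQP k) rfl rfl : DHom k [P, P] [P, P, Q, P])
            (comp (whisk [P, P] [] (capQP k) rfl rfl : DHom k [P, P, Q, P] [P, P])
              (whisk [P, P, Q] [] (dotP k) rfl rfl : DHom k [P, P, Q, P] [P, P, Q, P]))) := by
    have h := congrArg (fun f => (whisk [P, P] [] f rfl rfl : DHom k [P, P, Q, P] [P, P, Q, P]))
      (crossPQ_comp_crossQP k)
    simp only [whisk_add, whisk_smul, whisk_id, whisk_comp_append, whisk_whisk_append] at h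
    exact h
  have zigzag_top : comp (whisk [P] [P] (capPQ k) rfl rfl : DHom k [P, P, Q, P] [P, P])
      (whisk [P, P] [] (cupQP k) rfl rfl : DHom k [P, P] [P, P, Q, P]) = idm k [P, P] := by
    have h := congrArg (fun f => (whisk [P] [] f rfl rfl : DHom k [P, P] [P, P]))
      (zigzag_cupQP_capPQ k)
    simp only [whisk_id, whisk_comp_append, whisk_whisk_append] at h
    exact h
  have zigzag_bottom : comp (whisk [P, P] [] (capQP k) rfl rfl : DHom k [P, P, Q, P] [P, P])
      (whisk [P] [P] (cupPQ k) rfl rfl : DHom k [P, P] [P, P, Q, P]) = idm k [P, P] := by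
    have h := congrArg (fun f => (whisk [P] [] f rfl rfl : DHom k [P, P] [P, P]))
      (zigzag_cupPQ_capQP k)
    simp only [whisk_id, whisk_comp_append, whisk_whisk_append] at h
    exact h
  have cap_cross : comp (whisk [P, P] [] (capQP k) rfl rfl : DHom k [P, P, Q, P] [P, P])
      (whisk [] [Q, P] (cross k) rfl rfl : DHom k [P, P, Q, P] [P, P, Q, P]) = comp (cross k)
      (whisk [P, P] [] (capQP k) rfl rfl : DHom k [P, P, Q, P] [P, P]) := by
    have h : comp (whisk [P, P] [] (capQP k) rfl rfl : DHom k [P, P, Q, P] [P, P])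
      (whisk [] [Q, P] (cross k) rfl rfl : DHom k [P, P, Q, P] [P, P, Q, P]) =
        comp (whisk [] [] (cross k) rfl rfl : DHom k [P, P] [P, P])
          (whisk [P, P] [] (capQP k) rfl rfl : DHom k [P, P, Q, P] [P, P]) :=
      whisk_comm [] [] [] hasParity_gen hasParity_gen
    simpa only [whisk_nil_nil] using h
  have dot_cap : comp (whisk [P] [P] (capPQ k) rfl rfl : DHom k [P, P, Q, P] [P, P])
    (whisk [P, P, Q] [] (dotP k) rfl rfl : DHom k [P, P, Q, P] [P, P, Q, P]) =
      comp (whisk [P] [] (dotP k) rfl rfl : DHom k [P, P] [P, P]) (whisk [P] [P] (capPQ k) rfl rfl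
        : DHom k [P, P, Q, P] [P, P]) :=
    (whisk_comm [P] [] [] hasParity_gen hasParity_gen).symm
  have dot_slide : comp (whisk [P, P, Q] [] (dotP k) rfl rfl : DHom k [P, P, Q, P] [P, P, Q, P])
        (whisk [] [Q, P] (cross k) rfl rfl : DHom k [P, P, Q, P] [P, P, Q, P]) =
      comp (whisk [] [Q, P] (cross k) rfl rfl : DHom k [P, P, Q, P] [P, P, Q, P])
        (whisk [P, P, Q] [] (dotP k) rfl rfl : DHom k [P, P, Q, P] [P, P, Q, P]) :=
    whisk_comm [] [Q] [] hasParity_gen hasParity_gen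
  have dot_cup : comp (whisk [P, P, Q] [] (dotP k) rfl rfl : DHom k [P, P, Q, P] [P, P, Q, P])
    (whisk [P] [P] (cupPQ k) rfl rfl : DHom k [P, P] [P, P, Q, P]) =
      comp (whisk [P] [P] (cupPQ k) rfl rfl : DHom k [P, P] [P, P, Q, P])
        (whisk [P] [] (dotP k) rfl rfl : DHom k [P, P] [P, P]) :=
    whisk_comm [P] [] [] hasParity_gen hasParity_gen
  -- The cup is appended so that the braid relation matches the tail of a right-bracketed composite.
  have braid' := congrArg (fun f => comp f
    (whisk [P, P] [] (cupPQ k) rfl rfl : DHom k [P, P] [P, P, P, Q])) braid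
  simp only [comp_assoc] at braid'
  rw [curl_right, comp_assoc, comp_assoc, bottom, comp_eq_assoc top, braid', cup,
    comp_eq_assoc slide, comp_eq_assoc cap, ← comp_assoc _ (whisk [P, P] [] (crossQP k) rfl rfl
      : DHom k [P, P, Q, P] [P, P, P, Q]),
    double]
  simp only [add_comp, comp_add, smul_comp, comp_smul, comp_assoc, id_comp]
  -- The identity summand is the left curl picture `curl_left`. In the other two, the crossing moves
  -- above the lower cap and both zigzags straighten; in the last one the dots first leave the loop,
  -- one upwards and one downwards, both on the second strand.
  rw [← curl_left, comp_eq_id_assoc zigzag_top, comp_eq_assoc cap_cross, zigzag_bottom, comp_id,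
    comp_eq_assoc dot_cap, comp_eq_id_assoc zigzag_top, comp_eq_assoc dot_slide, dot_cup,
    comp_eq_assoc cap_cross, comp_eq_id_assoc zigzag_bottom]

/-- Left multiplication of the conjugation formula by the crossing; its dotted term becomes `s c₂ s
c₂ = c₁ s s c₂ = c₁ c₂`. -/
theorem cross_comp_curl :
    comp (cross k) (whisk [] [P] (curl k) rfl rfl : DHom k [P, P] [P, P]) =
      comp (whisk [P] [] (curl k) rfl rfl : DHom k [P, P] [P, P]) (cross k) + idm k [P, P] +
        comp (whisk [] [P] (dotP k) rfl rfl : DHom k [P, P] [P, P]) (whisk [P] [] (dotP k) rfl rfl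
          : DHom k [P, P] [P, P]) := by
  have h := congrArg (comp (cross k)) (cross_comp_curl_comp_cross k)
  rw [comp_eq_id_assoc (cross_comp_cross k)] at h
  rw [h]
  simp only [comp_add, comp_smul, cross_comp_cross, ← comp_eq_assoc (dot_comp_cross k),
    comp_eq_id_assoc (cross_comp_cross k)]
  simp only [neg_smul, one_smul]
  abel

/-- Right multiplication of the conjugation formula by the crossing; now the dotted term is `c₂ s c₂
s = c₂ s s c₁ = c₂ c₁`, and reordering the odd dots flips its sign. -/
theorem curl_comp_cross :
    comp (whisk [] [P] (curl k) rfl rfl : DHom k [P, P] [P, P]) (cross k) =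
      comp (cross k) (whisk [P] [] (curl k) rfl rfl : DHom k [P, P] [P, P]) + idm k [P, P] -
        comp (whisk [] [P] (dotP k) rfl rfl : DHom k [P, P] [P, P]) (whisk [P] [] (dotP k) rfl rfl
          : DHom k [P, P] [P, P]) := by
  have anti : comp (whisk [P] [] (dotP k) rfl rfl : DHom k [P, P] [P, P])
    (whisk [] [P] (dotP k) rfl rfl : DHom k [P, P] [P, P]) =
      (-1 : k) • comp (whisk [] [P] (dotP k) rfl rfl : DHom k [P, P] [P, P])
      (whisk [P] [] (dotP k) rfl rfl : DHom k [P, P] [P, P]) := by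
    refine (whisk_exchange (u := []) (m := []) (v := []) (s₁ := [P, P]) (ul := [P]) (vr := [P])
      (ul' := [P]) (vr' := [P])
      (hasParity_gen (g := .dotP)) (hasParity_gen (g := .dotP))
      rfl rfl rfl rfl rfl rfl rfl rfl rfl rfl rfl rfl).trans ?_
    simp only [Generator.parity, ZMod.val_one, mul_one, pow_one]
  have h := congrArg (fun f => comp f (cross k)) (cross_comp_curl_comp_cross k)
  simp only [comp_assoc, add_comp, smul_comp, cross_comp_cross, comp_id,
    ← cross_comp_dot] at h
  rw [h, comp_eq_id_assoc (cross_comp_cross k), anti]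
  simp only [neg_smul, one_smul]
  abel

end Generators

end DHom

/-! ### Transfer to endomorphisms of `P^n`. -/

namespace Ht

open DHom

variable {k : Type u} [CommRing k] {n : ℕ}

theorem toEnd_comp (g f : DHom k (powP n) (powP n)) :
    toEnd (DHom.comp g f) = toEnd g * toEnd f :=
  (incl k).map_comp (X := ⟨powP n, 0⟩) (Y := ⟨powP n, 0⟩) (Z := ⟨powP n, 0⟩) f g

theorem toEnd_id : toEnd (idm k (powP n)) = 1 :=
  (incl k).map_id ⟨powP n, 0⟩

theorem toEnd_add (f g : DHom k (powP n) (powP n)) : toEnd (f + g) = toEnd f + toEnd g := by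
  refine ObjectProperty.hom_ext _ ?_
  exact (Mat_.embedding (Shifted k) ⋙ Idempotents.toKaroubi _).map_add
    (X := ⟨powP n, 0⟩) (Y := ⟨powP n, 0⟩) (f := f) (g := g)

/-- `toEnd` as an additive map. -/
noncomputable def toEndHom (k : Type u) [CommRing k] (n : ℕ) :
    DHom k (powP n) (powP n) →+ End (Pn k n) where
  toFun := toEnd
  map_zero' := by simpa using toEnd_add (k := k) (n := n) 0 0
  map_add' := toEnd_add

theorem toEnd_neg (f : DHom k (powP n) (powP n)) : toEnd (-f) = -toEnd f :=
  map_neg (toEndHom k n) f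

theorem place_comp (a m : ℕ) (h : a + m ≤ n) (g f : DHom k (powP m) (powP m)) :
    place a m h (DHom.comp g f) = place a m h g * place a m h f := by
  rw [place, place, place, ← toEnd_comp]
  exact congrArg toEnd (whisk_comp _ _ _ _ _ _ _)

theorem place_add (a m : ℕ) (h : a + m ≤ n) (f g : DHom k (powP m) (powP m)) :
    place a m h (f + g) = place a m h f + place a m h g := by
  rw [place, place, place, ← toEnd_add]
  exact congrArg toEnd (whisk_add _ _ _ _ _ _)

/-- Negation of morphisms is defined as scaling by `-1`, so additivity of `toEnd` suffices here. -/
theorem place_smul_neg_one (a m : ℕ) (h : a + m ≤ n) (f : DHom k (powP m) (powP m)) :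
    place a m h ((-1 : k) • f) = -place a m h f := by
  rw [place, place, ← toEnd_neg]
  exact congrArg toEnd (whisk_smul _ _ _ _ _ _)

theorem place_sub (a m : ℕ) (h : a + m ≤ n) (f g : DHom k (powP m) (powP m)) :
    place a m h (f - g) = place a m h f - place a m h g := by
  rw [sub_eq_add_neg, sub_eq_add_neg, place_add]
  exact congrArg _ (place_smul_neg_one a m h g)

theorem place_id (a m : ℕ) (h : a + m ≤ n) : place a m h (idm k (powP m)) = 1 := by
  rw [← toEnd_id]
  exact congrArg toEnd (whisk_id _ _ _ _)

/-- Placing a diagram on the left part of a block of strands. -/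
theorem place_whisk (a m b l c : ℕ) (h : a + m ≤ n) (hl : m = b + (l + c))
    (f : DHom k (powP l) (powP l)) (hs : powP m = powP b ++ (powP l ++ powP c)) :
    place a m h (whisk (powP b) (powP c) f hs hs) = place (a + b) l (by omega) f := by
  refine congrArg toEnd (whisk_whisk f hs hs _ _ ?_ ?_)
  · simp
  · simp
    omega

/-- Endomorphisms of disjoint sets of strands supercommute. -/
theorem place_comm {a m b l : ℕ} (hab : a + m ≤ b) (hb : b + l ≤ n)
    {f : DHom k (powP m) (powP m)} {g : DHom k (powP l) (powP l)} {p q : ZMod 2}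
    (hf : HasParity f p) (hg : HasParity g q) (hpq : p.val * q.val = 0) :
    place b l hb g * place a m (by omega) f = place a m (by omega) f * place b l hb g := by
  simp only [place, ← toEnd_comp]
  -- Exactly `b - a - m` strands separate the two blocks.
  refine congrArg toEnd (whisk_comm (powP a) (powP (b - a - m)) (powP (n - b - l)) hf hg hpq
    ?_ ?_ ?_ ?_)
  all_goals
    simp only [List.replicate_append_replicate]
    congr 1
    omega

/-- A morphism on the left one of two adjacent strands. -/
theorem place_left (i : ℕ) (h : i + 1 < n) (f : DHom k [P] [P]) :
    place (n := n) i 2 h (whisk [] [P] f rfl rfl) = place i 1 (Nat.lt_of_succ_lt h) f :=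
  place_whisk i 2 0 1 1 h rfl f rfl

/-- A morphism on the right one of two adjacent strands. -/
theorem place_right (i : ℕ) (h : i + 1 < n) (f : DHom k [P] [P]) :
    place (n := n) i 2 h (whisk [P] [] f rfl rfl) = place (i + 1) 1 h f :=
  place_whisk i 2 1 1 0 h rfl f rfl

/-! ### The affine Sergeev relations. -/

theorem T_mul_X (i : ℕ) (h : i + 1 < n) :
    T k n i h * X k n ⟨i, Nat.lt_of_succ_lt h⟩ =
      X k n ⟨i + 1, h⟩ * T k n i h + 1 + C k n ⟨i, Nat.lt_of_succ_lt h⟩ * C k n ⟨i + 1, h⟩ := by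
  have key := congrArg (place (n := n) i 2 h) (cross_comp_curl k)
  -- `[P, P]` is `powP 2` only after unfolding, so the rewriting rule is restated for the literal
  -- word.
  have one : place (n := n) i 2 h (idm k [P, P]) = 1 := place_id i 2 h
  rw [place_add, place_add, place_comp, place_comp, place_comp, one, place_left, place_right,
    place_left, place_right] at key
  exact key

theorem X_mul_T (i : ℕ) (h : i + 1 < n) :
    X k n ⟨i, Nat.lt_of_succ_lt h⟩ * T k n i h =
      T k n i h * X k n ⟨i + 1, h⟩ + 1 - C k n ⟨i, Nat.lt_of_succ_lt h⟩ * C k n ⟨i + 1, h⟩ := by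
  have key := congrArg (place (n := n) i 2 h) (curl_comp_cross k)
  have one : place (n := n) i 2 h (idm k [P, P]) = 1 := place_id i 2 h
  rw [place_sub, place_add, place_comp, place_comp, place_comp, one, place_left, place_right,
    place_left, place_right] at key
  exact key

/-- On distinct strands the even curl commutes with the odd dot without a sign; on a common strand
the sign is that of `dot_comp_curl`. -/
theorem C_mul_X (i j : Fin n) :
    C k n i * X k n j = (-1) ^ (if i = j then 1 else 0) * (X k n j * C k n i) := by
  obtain hij | rfl | hij := lt_trichotomy i j
  · rw [if_neg hij.ne, pow_zero, one_mul]
    exact (place_comm (Nat.succ_le_of_lt hij) j.isLt hasParity_gen (hasParity_curl k) rfl).symm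
  · rw [if_pos rfl, pow_one, neg_one_mul]
    have key := congrArg (place (n := n) i 1 i.isLt) (dot_comp_curl k)
    rw [place_smul_neg_one, place_comp, place_comp] at key
    exact key
  · rw [if_neg hij.ne', pow_zero, one_mul]
    exact place_comm (Nat.succ_le_of_lt hij) i.isLt (hasParity_curl k) hasParity_gen rfl

/-- Each curl closes up within its own strand, so distinct curls are even diagrams on disjoint
strands. -/
theorem X_mul_X (i j : Fin n) : X k n i * X k n j = X k n j * X k n i := by
  obtain hij | rfl | hij := lt_trichotomy i j
  · exact (place_comm (Nat.succ_le_of_lt hij) j.isLt (hasParity_curl k) (hasParity_curl k)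
      rfl).symm
  · rfl
  · exact place_comm (Nat.succ_le_of_lt hij) i.isLt (hasParity_curl k) (hasParity_curl k) rfl

end Ht

end TwistedHeisenberg

open TwistedHeisenberg in
theorem mainTheorem3 (k : Type u) [Field k] [CharZero k] (n : ℕ) :
    (∀ (i : ℕ) (h : i + 1 < n),
      Ht.T k n i h * Ht.X k n ⟨i, Nat.lt_of_succ_lt h⟩ =
        Ht.X k n ⟨i + 1, h⟩ * Ht.T k n i h + 1 +
          Ht.C k n ⟨i, Nat.lt_of_succ_lt h⟩ * Ht.C k n ⟨i + 1, h⟩) ∧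
    (∀ (i : ℕ) (h : i + 1 < n),
      Ht.X k n ⟨i, Nat.lt_of_succ_lt h⟩ * Ht.T k n i h =
        Ht.T k n i h * Ht.X k n ⟨i + 1, h⟩ + 1 -
          Ht.C k n ⟨i, Nat.lt_of_succ_lt h⟩ * Ht.C k n ⟨i + 1, h⟩) ∧
    (∀ i j : Fin n,
      Ht.C k n i * Ht.X k n j = (-1) ^ (if i = j then 1 else 0) * (Ht.X k n j * Ht.C k n i)) ∧
    (∀ i j : Fin n, Ht.X k n i * Ht.X k n j = Ht.X k n j * Ht.X k n i) :=
  ⟨Ht.T_mul_X, Ht.X_mul_T, Ht.C_mul_X, Ht.X_mul_X⟩
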